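/- For a finite matroid $M$ with lattice of flats $L(M)$, let $P_M(t)\in\mathbb Z[t]$ be its Kazhdan–Lusztig polynomial, i.e. the member at $M$ of the unique family such that $P_M=1$ if $\operatorname{rk}M=0$, $\deg P_M<\tfrac12\operatorname{rk}M$ if $\operatorname{rk}M>0$, and $Z_M(t)=\sum_{F\in L(M)}t^{\operatorname{rk}F}P_{M/F}(t)$ satisfies $Z_M(t)=t^{\operatorname{rk}M}Z_M(t^{-1})$ for all $M$ (matroids with isomorphic lattices of flats have the same polynomial). For a finite graph $G$ put $P_G=P_{M_G}$, where $M_G$ is the graphic matroid of $G$: its ground set is the edge set, and its independent sets are the sets of edges containing no cycle. For $m\ge 2$ let $C_m$ be the cycle with $m$ vertices, where $C_2$ is a single edge. For $n\ge 3$ and $0\le r\le n$, a partial saw graph $S_{n,r}$ is a graph obtained from an $n$-cycle by choosing $r$ different edges of it and gluing a triangle along each chosen edge (for each chosen edge, a new vertex is added and joined to the two ends of that edge). For $n=2$ and $0\le r\le 2$, $S_{2,r}$ is a single edge with $r$ triangles glued along it. Then, for all $n\ge 2$ and $0\le r\le n$ and every partial saw graph $S_{n,r}$, \[ P_{S_{n,r}}(t)=\sum_{k=0}^{r}(-t)^k\binom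 rk\,p_{n+r-2k}(t) \] in $\mathbb Z[t,t^{-1}]$, where $p_m(t)=P_{C_m}(t)$ for $m\ge 2$, $p_1(t)=0$ and $p_0(t)=t^{-1}$. Moreover, for all $n\ge 3$ and $1\le r\le n$, \[ P_{S_{n,r}}(t)=P_{S_{n+1,r-1}}(t)-t\,P_{S_{n-1,r-1}}(t), \] for every choice of the three partial saw graphs. -/

import Mathlib

open scoped Polynomial LaurentPolynomial

namespace Matroid

/-- The rank of a set in a matroid, as a natural number (all matroids below are finite). -/
noncomputable def natRk {α : Type*} (M : Matroid α) (X : Set α) : ℕ := (M.eRk X).toNat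

/-- The rank of a matroid, as a natural number. -/
noncomputable def natRank {α : Type*} (M : Matroid α) : ℕ := M.natRk M.E

theorem finite_setOf_isFlat {α : Type*} (M : Matroid α) [M.Finite] : {F | M.IsFlat F}.Finite :=
  M.ground_finite.finite_subsets.subset fun _ hF => hF.subset_ground

/-- The lattice of flats of a finite matroid, as a finite set of sets. -/
noncomputable def flats {α : Type*} (M : Matroid α) [M.Finite] : Finset (Set α) :=
  M.finite_setOf_isFlat.toFinset

@[simp] theorem mem_flats {α : Type*} {M : Matroid α} [M.Finite] {F : Set α} :
    F ∈ M.flats ↔ M.IsFlat F := by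
  simp [flats]

open Classical in
/-- The flats of positive rank, that is, all flats except the minimal one. -/
noncomputable def posFlats {α : Type*} (M : Matroid α) [M.Finite] : Finset (Set α) :=
  M.flats.filter fun F => 0 < M.natRk F

theorem mem_posFlats {α : Type*} {M : Matroid α} [M.Finite] {F : Set α} :
    F ∈ M.posFlats ↔ M.IsFlat F ∧ 0 < M.natRk F := by
  simp [posFlats]

theorem ncard_ground_contract_lt {α : Type*} {M : Matroid α} [M.Finite] {F : Set α}
    (hF : F ∈ M.posFlats) : (M ／ F).E.ncard < M.E.ncard := by
  rw [mem_posFlats] at hF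
  have hne : F.Nonempty := by
    rw [Set.nonempty_iff_ne_empty]
    rintro rfl
    simp [natRk] at hF
  refine Set.ncard_lt_ncard ?_ M.ground_finite
  obtain ⟨x, hx⟩ := hne
  exact ⟨Set.sdiff_subset, fun h => (h (hF.1.subset_ground hx)).2 hx⟩

/-- The Kazhdan–Lusztig polynomial `P_M` of a finite matroid `M` of rank `d`.  It is `1` if `d = 0`.
If `d > 0`, let `f = ∑ t ^ rk F * P_{M / F}`, over all flats `F` except the minimal one; then `P_M` is
the unique polynomial of degree less than `d / 2` such that `f + P_M` is palindromic of degree `d`: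
its coefficient of `t ^ k` is `f_{d - k} - f_k` for `2 * k < d` and `0` otherwise. -/
noncomputable def klPoly {α : Type*} (M : Matroid α) [M.Finite] : ℤ[X] :=
  if M.natRank = 0 then 1 else
    let f : ℤ[X] := ∑ F ∈ M.posFlats.attach, Polynomial.X ^ M.natRk F.1 * klPoly (M ／ F.1)
    ∑ k ∈ Finset.range ((M.natRank + 1) / 2),
      Polynomial.monomial k (f.coeff (M.natRank - k) - f.coeff k)
termination_by M.E.ncard
decreasing_by exact ncard_ground_contract_lt F.2

/-- The `Z`-polynomial `Z_M(t) = ∑ t ^ rk F * P_{M / F}(t)`, summed over all flats `F` of `M`. -/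
noncomputable def zPoly {α : Type*} (M : Matroid α) [M.Finite] : ℤ[X] :=
  ∑ F ∈ M.flats, Polynomial.X ^ M.natRk F * (M ／ F).klPoly

/-- Defining property (a): `P_M = 1` in rank zero. -/
theorem klPoly_of_natRank_eq_zero {α : Type*} {M : Matroid α} [M.Finite] (h : M.natRank = 0) :
    M.klPoly = 1 := by
  rw [klPoly, if_pos h]

theorem coeff_klPoly {α : Type*} {M : Matroid α} [M.Finite] (h : M.natRank ≠ 0) (k : ℕ) :
    M.klPoly.coeff k =
      if 2 * k < M.natRank then
        (∑ F ∈ M.posFlats, Polynomial.X ^ M.natRk F * (M ／ F).klPoly).coeff (M.natRank - k) -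
        (∑ F ∈ M.posFlats, Polynomial.X ^ M.natRk F * (M ／ F).klPoly).coeff k
      else 0 := by
  rw [klPoly, if_neg h]
  simp only [Polynomial.finsetSum_coeff (s := Finset.range _), Polynomial.coeff_monomial,
    Finset.sum_ite_eq', Finset.mem_range]
  rw [Finset.sum_attach M.posFlats fun F => Polynomial.X ^ M.natRk F * (M ／ F).klPoly]
  exact if_congr (by omega) rfl rfl

/-- Defining property (b): `deg P_M < (rk M) / 2` in positive rank. -/
theorem two_mul_natDegree_klPoly_lt {α : Type*} {M : Matroid α} [M.Finite] (h : M.natRank ≠ 0) :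
    2 * M.klPoly.natDegree < M.natRank := by
  by_contra hlt
  have h0 : M.klPoly.leadingCoeff = 0 := by
    rw [Polynomial.leadingCoeff, coeff_klPoly h, if_neg hlt]
  rw [Polynomial.leadingCoeff_eq_zero] at h0
  rw [h0] at hlt
  simp at hlt
  exact h hlt

theorem natDegree_klPoly_le {α : Type*} (M : Matroid α) [M.Finite] :
    M.klPoly.natDegree ≤ M.natRank := by
  by_cases h : M.natRank = 0
  · simp [klPoly_of_natRank_eq_zero h]
  · have := two_mul_natDegree_klPoly_lt h
    omega

theorem natRk_add_natRank_contract {α : Type*} {M : Matroid α} [M.Finite] {F : Set α}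
    (hF : F ⊆ M.E) : M.natRk F + (M ／ F).natRank = M.natRank := by
  obtain ⟨I, hI⟩ := M.exists_isBasis F
  obtain ⟨B, hB, hIB⟩ := hI.indep.exists_isBase_superset
  have hB' : (M ／ F).IsBasis (B \ I) (M.E \ F) := by
    rw [hI.contract_eq_contract_delete, delete_isBasis_iff]
    refine ⟨hI.contract_sdiff_isBasis_sdiff hB.isBasis_ground hIB, ?_⟩
    exact Set.disjoint_sdiff_left.mono_right Set.sdiff_subset
  have h1 : (M ／ F).natRank = (B \ I).ncard := by
    rw [natRank, natRk, contract_ground, ← hB'.encard_eq_eRk, Set.ncard]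
  have h2 : M.natRank = B.ncard := by
    rw [natRank, natRk, ← hB.isBasis_ground.encard_eq_eRk, Set.ncard]
  have h3 : M.natRk F = I.ncard := by
    rw [natRk, ← hI.encard_eq_eRk, Set.ncard]
  have hfin : B.Finite := M.ground_finite.subset hB.subset_ground
  rw [h1, h2, h3, add_comm, Set.ncard_sdiff_add_ncard_of_subset hIB hfin]

theorem natRk_eq_zero_iff {α : Type*} {M : Matroid α} [M.Finite] [M.Loopless] {F : Set α}
    (hF : F ⊆ M.E) : M.natRk F = 0 ↔ F = ∅ := by
  have hfin : M.eRk F ≠ ⊤ :=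
    ne_top_of_le_ne_top (by simpa using M.ground_finite.subset hF) (M.eRk_le_encard F)
  rw [natRk, ENat.toNat_eq_zero, or_iff_left hfin, eRk_eq_zero_iff hF, loops_eq_empty,
    Set.subset_empty_iff]

theorem zPoly_eq {α : Type*} (M : Matroid α) [M.Finite] [M.Loopless] :
    M.zPoly = M.klPoly + ∑ F ∈ M.posFlats, Polynomial.X ^ M.natRk F * (M ／ F).klPoly := by
  classical
  have hflats : M.flats = insert ∅ M.posFlats := by
    ext F
    rw [mem_flats, Finset.mem_insert, mem_posFlats]
    constructor
    · intro hF
      by_cases h : F = ∅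
      · exact Or.inl h
      · exact Or.inr ⟨hF, Nat.pos_of_ne_zero fun h0 => h ((natRk_eq_zero_iff hF.subset_ground).1 h0)⟩
    · rintro (rfl | h)
      · rw [← M.loops_eq_empty]
        exact isFlat_closure ∅
      · exact h.1
  have hnot : (∅ : Set α) ∉ M.posFlats := by simp [mem_posFlats, natRk]
  have hM : (M ／ (∅ : Set α)).klPoly = M.klPoly := by
    congr 1
    exact M.contract_empty
  rw [zPoly, hflats, Finset.sum_insert hnot, hM]
  simp [natRk]

/-- Defining property (c): `Z_M` is palindromic of degree `rk M`. -/
theorem zPoly_palindromic {α : Type*} {M : Matroid α} [M.Finite] [M.Loopless] :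
    M.zPoly.natDegree ≤ M.natRank ∧
      ∀ i j, i + j = M.natRank → M.zPoly.coeff i = M.zPoly.coeff j := by
  constructor
  · refine Polynomial.natDegree_sum_le_of_forall_le _ _ fun F hF => ?_
    have h1 := (M ／ F).natDegree_klPoly_le
    have h2 := natRk_add_natRank_contract (mem_flats.1 hF).subset_ground
    refine Polynomial.natDegree_mul_le.trans ?_
    rw [Polynomial.natDegree_X_pow]
    omega
  · intro i j hij
    by_cases h : M.natRank = 0
    · rw [show i = j by omega]
    · rw [zPoly_eq, Polynomial.coeff_add, Polynomial.coeff_add, coeff_klPoly h, coeff_klPoly h]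
      rcases lt_trichotomy i j with hlt | rfl | hlt
      · rw [if_pos (by omega), if_neg (by omega), show M.natRank - i = j by omega]
        ring
      · rfl
      · rw [if_neg (by omega), if_pos (by omega), show M.natRank - j = i by omega]
        ring

end Matroid

namespace SimpleGraph

theorem maximal_fromEdgeSet_iff {V : Type*} (G : SimpleGraph V) {I : Set (Sym2 V)}
    (hI : I ⊆ G.edgeSet) :
    Maximal (fun I => I ⊆ G.edgeSet ∧ (fromEdgeSet I).IsAcyclic) I ↔
      Maximal (fun H => H ≤ G ∧ H.IsAcyclic) (fromEdgeSet I) := by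
  have key : ∀ J : Set (Sym2 V), J ⊆ G.edgeSet → (fromEdgeSet J).edgeSet = J := by
    intro J hJ
    rw [edgeSet_fromEdgeSet, sdiff_eq_left]
    exact Set.disjoint_left.2 fun e he hd => G.not_isDiag_of_mem_edgeSet (hJ he) hd
  constructor
  · rintro ⟨⟨_, h1⟩, h2⟩
    refine ⟨⟨by rw [← edgeSet_subset_edgeSet, key I hI]; exact hI, h1⟩, ?_⟩
    intro H hH hle
    rw [← edgeSet_subset_edgeSet, key I hI] at hle ⊢
    exact h2 ⟨edgeSet_subset_edgeSet.2 hH.1, by rw [fromEdgeSet_edgeSet]; exact hH.2⟩ hle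
  · rintro ⟨⟨_, h1⟩, h2⟩
    refine ⟨⟨hI, h1⟩, ?_⟩
    intro J hJ hle
    have := h2 (y := fromEdgeSet J)
      ⟨by rw [← edgeSet_subset_edgeSet, key J hJ.1]; exact hJ.1, hJ.2⟩ (fromEdgeSet_mono hle)
    rw [← edgeSet_subset_edgeSet, key I hI, key J hJ.1] at this
    exact this

/-- The graphic matroid `M_G` of a finite graph `G`: the ground set is the edge set of `G`, and a set
of edges is independent if it contains no cycle. -/
noncomputable def graphicMatroid {V : Type*} [Finite V] (G : SimpleGraph V) : Matroid (Sym2 V) :=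
  (IndepMatroid.ofBdd (E := G.edgeSet)
    (Indep := fun I => I ⊆ G.edgeSet ∧ (fromEdgeSet I).IsAcyclic)
    (indep_empty := by simp)
    (indep_subset := fun I J hJ hIJ => ⟨hIJ.trans hJ.1, hJ.2.anti (fromEdgeSet_mono hIJ)⟩)
    (indep_aug := by
      intro I B hI hImax hB
      by_contra! hcon
      refine hImax ((maximal_fromEdgeSet_iff G hI.1).2 ?_)
      have hBr := reachable_eq_of_maximal_isAcyclic _ ((maximal_fromEdgeSet_iff G hB.prop.1).1 hB)
      have hle : fromEdgeSet I ≤ G := by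
        rw [fromEdgeSet_le]
        exact Set.sdiff_subset.trans hI.1
      rw [maximal_isAcyclic_iff_reachable_eq hle hI.2, ← hBr]
      have hadj : ∀ u v, (fromEdgeSet B).Adj u v → (fromEdgeSet I).Reachable u v := by
        intro u v huv
        rw [fromEdgeSet_adj] at huv
        by_contra hr
        have hmem : s(u, v) ∉ I := fun h =>
          hr (Adj.reachable ((fromEdgeSet_adj I).2 ⟨h, huv.2⟩))
        refine hcon _ ⟨huv.1, hmem⟩ (Set.insert_subset (hB.prop.1 huv.1) hI.1) ?_
        have := IsAcyclic.sup_edge_of_not_reachable hr hI.2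
        rwa [edge, ← fromEdgeSet_union, Set.union_comm, ← Set.insert_eq] at this
      funext u v
      refine propext ⟨fun h => ?_, fun h => ?_⟩
      · rw [hBr]
        exact h.mono hle
      · obtain ⟨p⟩ := h
        clear hBr
        induction p with
        | nil => exact Reachable.refl _
        | cons h _ ih => exact (hadj _ _ h).trans ih)
    (subset_ground := fun I hI => hI.1)
    (indep_bdd := ⟨G.edgeSet.ncard, fun I hI => by
      rw [(Set.toFinite G.edgeSet).cast_ncard_eq]
      exact Set.encard_le_encard hI.1⟩)).matroid

theorem graphicMatroid_ground {V : Type*} [Finite V] (G : SimpleGraph V) :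
    G.graphicMatroid.E = G.edgeSet := rfl

theorem graphicMatroid_indep_iff {V : Type*} [Finite V] (G : SimpleGraph V) (I : Set (Sym2 V)) :
    G.graphicMatroid.Indep I ↔ I ⊆ G.edgeSet ∧ (fromEdgeSet I).IsAcyclic := Iff.rfl

instance {V : Type*} [Finite V] (G : SimpleGraph V) : G.graphicMatroid.Finite :=
  ⟨Set.toFinite G.edgeSet⟩

/-- The Kazhdan–Lusztig polynomial `P_G` of a finite graph. -/
noncomputable def klPoly {V : Type*} [Finite V] (G : SimpleGraph V) : ℤ[X] :=
  G.graphicMatroid.klPoly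

/-- The `n`-cycle on `Fin n` with a triangle glued on its edge `{i, i + 1}` for every `i ∈ S`
(`finRotate n i` is `i + 1` modulo `n`).  The vertex `Sum.inr i` is the tip of the triangle at the
edge `{i, i + 1}`.  For `n = 2` the cycle is a single edge, and all triangles share it. -/
def sawGraph (n : ℕ) (S : Finset (Fin n)) : SimpleGraph (Fin n ⊕ S) where
  Adj
    | .inl i, .inl j => (cycleGraph n).Adj i j
    | .inl j, .inr i => j = i.1 ∨ j = finRotate n i.1
    | .inr i, .inl j => j = i.1 ∨ j = finRotate n i.1
    | .inr _, .inr _ => False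
  symm := ⟨by
    rintro (i | i) (j | j) h
    · exact h.symm
    · exact h
    · exact h
    · exact h⟩
  loopless := ⟨by
    rintro (i | i) h
    · exact (cycleGraph n).loopless.irrefl i h
    · exact h⟩

/-- `G` is a partial saw graph `S_{n,r}`: an `n`-cycle with `r` triangles glued on along `r` different
edges of the cycle. -/
def IsPartialSaw {V : Type*} (G : SimpleGraph V) (n r : ℕ) : Prop :=
  ∃ S : Finset (Fin n), S.card = r ∧ Nonempty (G ≃g sawGraph n S)

end SimpleGraph

/-- The Laurent polynomials `p_0 = t⁻¹`, `p_1 = 0` and `p_m = P_{C_m}` for `m ≥ 2`, where `C_m` is the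
cycle with `m` vertices (`C_2` is a single edge). -/
noncomputable def cyclePoly : ℕ → ℤ[T;T⁻¹]
  | 0 => LaurentPolynomial.T (-1)
  | 1 => 0
  | m + 2 => (SimpleGraph.cycleGraph (m + 2)).klPoly.toLaurent

/-! Everything rests on one deletion formula. Suppose a triangle `{e, f, g}` is glued along `e` to
the rest of a matroid in which `e` is not a coloop, as when a vertex of degree two is attached to
the ends of a non-bridge `e`. Then `P_M = P_{M \ e} - t P_{M / e}` (`IsGluedTriangle.klPoly_eq`).

For its proof, compare the flats of `M` and `M \ e`: `Z_M - Z_{M \ e}` is a sum of `t ^ rk F *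
(P_{M/F} - P_{(M \ e)/F} + t P_{M/(F ∪ e)})` over the flats `F` not containing `e` for which `F ∪ e`
is a flat (`zPoly_sub_zPoly_delete`). The triangle survives in each such `M / F`, so by induction
only the term of `F = ∅` remains. That term is then palindromic of degree `rk M`, being a difference
of two `Z`-polynomials, yet its degree is below `rk M / 2`; hence it is zero. The degree bound on `t
P_{M/e}` holds because `f, g` become a parallel class in `M / e` that is a coloop up to parallelism,
and contracting it lowers the rank once more without changing the polynomial
(`IsParallelColoop.klPoly_eq`).

For `S_{n,r}` and an edge carrying a triangle, deletion lengthens the cycle through the tip and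
gives `S_{n+1,r-1}`, while contracting the whole triangle gives `S_{n-1,r-1}`. By Pascal's rule the
closed formula obeys the same recursion, so induction on `r` finishes. The recursion does not reach
`n = 2`, where `S_{2,1} = C_3` and `S_{2,2} = S_{3,1}` are used; the conventions `p_1 = 0` and `p_0
= t⁻¹` fit exactly these cases. -/

namespace Polynomial

/-! ### Palindromic polynomials. -/

/-- `p` is palindromic of degree `d`, that is, `p(t) = t ^ d * p(t⁻¹)`. -/
def IsPalindromic (d : ℕ) (p : ℤ[X]) : Prop :=
  p.natDegree ≤ d ∧ ∀ i j, i + j = d → p.coeff i = p.coeff j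

theorem IsPalindromic.sub {d : ℕ} {p q : ℤ[X]} (hp : p.IsPalindromic d) (hq : q.IsPalindromic d) :
    (p - q).IsPalindromic d :=
  ⟨(natDegree_sub_le p q).trans (max_le hp.1 hq.1), fun i j h => by
    rw [coeff_sub, coeff_sub, hp.2 i j h, hq.2 i j h]⟩

theorem IsPalindromic.one_add_X_mul {d : ℕ} {p : ℤ[X]} (hp : p.IsPalindromic d) :
    ((1 + X) * p).IsPalindromic (d + 1) := by
  have hz : p.coeff (d + 1) = 0 := coeff_eq_zero_of_natDegree_lt (Nat.lt_succ_of_le hp.1)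
  constructor
  · refine natDegree_mul_le.trans ?_
    have h1 : (1 + X : ℤ[X]).natDegree ≤ 1 := by compute_degree
    have h2 := hp.1
    omega
  · intro i j h
    rw [add_mul, one_mul, coeff_add, coeff_add]
    rcases i with _ | i <;> rcases j with _ | j
    · rfl
    · obtain rfl : j = d := by omega
      simp [coeff_X_mul, hz, hp.2 0 j (by omega)]
    · obtain rfl : i = d := by omega
      simp [coeff_X_mul, hz, hp.2 0 i (by omega)]
    · rw [coeff_X_mul, coeff_X_mul, hp.2 (i + 1) j (by omega), hp.2 i (j + 1) (by omega), add_comm]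

/-- The leading coefficient is mirrored to a position beyond the degree. This is how every identity
between Kazhdan–Lusztig polynomials below is concluded. -/
theorem IsPalindromic.eq_zero {d : ℕ} {p : ℤ[X]} (hp : p.IsPalindromic d)
    (h : 2 * p.natDegree < d) : p = 0 := by
  rw [← leadingCoeff_eq_zero, leadingCoeff, hp.2 p.natDegree (d - p.natDegree) (by omega)]
  exact coeff_eq_zero_of_natDegree_lt (by omega)

end Polynomial

/-! ### Rank, flats and contraction. -/

namespace Matroid

open Polynomial

variable {α β : Type*}

theorem klPoly_congr {M N : Matroid α} [M.Finite] [N.Finite] (h : M = N) :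
    M.klPoly = N.klPoly := by
  subst h
  rfl

theorem isPalindromic_zPoly (M : Matroid α) [M.Finite] [M.Loopless] :
    M.zPoly.IsPalindromic M.natRank :=
  zPoly_palindromic

theorem eRk_ne_top (M : Matroid α) [M.Finite] (X : Set α) : M.eRk X ≠ ⊤ := by
  rw [← M.eRk_inter_ground]
  exact ne_top_of_le_ne_top (by simpa using M.ground_finite.subset Set.inter_subset_right)
    (M.eRk_le_encard _)

theorem natRk_insert {M : Matroid α} [M.Finite] {e : α} {X : Set α} (he : e ∈ M.E)
    (heX : e ∉ M.closure X) : M.natRk (insert e X) = M.natRk X + 1 := by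
  rw [natRk, natRk, eRk_insert_eq_add_one ⟨he, heX⟩, ENat.toNat_add (M.eRk_ne_top X) (by simp)]
  rfl

theorem natRk_eq_of_closure_eq {M : Matroid α} {X Y : Set α} (h : M.closure X = M.closure Y) :
    M.natRk X = M.natRk Y := by
  rw [natRk, natRk, ← M.eRk_closure_eq X, h, M.eRk_closure_eq]

theorem isFlat_contract_iff {M : Matroid α} {C F : Set α} (hC : C ⊆ M.E) :
    (M ／ C).IsFlat F ↔ Disjoint F C ∧ M.IsFlat (F ∪ C) := by
  rw [isFlat_iff_closure_eq, isFlat_iff_closure_eq, contract_closure_eq]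
  constructor
  · intro h
    have hsub : C ⊆ M.closure (F ∪ C) := M.subset_closure_of_subset' Set.subset_union_right hC
    refine ⟨?_, ?_⟩
    · rw [← h]
      exact Set.disjoint_sdiff_left
    · rw [← Set.sdiff_union_of_subset hsub, h]
  · rintro ⟨h1, h2⟩
    rw [h2, Set.union_sdiff_right, h1.sdiff_eq_left]

theorem IsFlat.sdiff_contract {M : Matroid α} {C F : Set α} (hF : M.IsFlat F) (hCF : C ⊆ F) :
    (M ／ C).IsFlat (F \ C) := by
  rw [isFlat_contract_iff (hCF.trans hF.subset_ground), Set.sdiff_union_of_subset hCF]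
  exact ⟨Set.disjoint_sdiff_left, hF⟩

theorem IsFlat.contract_loopless {M : Matroid α} {F : Set α} (hF : M.IsFlat F) :
    (M ／ F).Loopless := by
  rw [loopless_iff, contract_loops_eq, hF.closure, Set.sdiff_self]

theorem natRk_add_natRk_contract {M : Matroid α} [M.Finite] {C X : Set α} (hCX : C ⊆ X)
    (hX : X ⊆ M.E) : M.natRk C + (M ／ C).natRk (X \ C) = M.natRk X := by
  have : (M ↾ X).Finite := ⟨M.ground_finite.subset hX⟩
  have h := natRk_add_natRank_contract (M := M ↾ X) (F := C) hCX
  rw [natRank, natRank, M.restrict_contract_eq_contract_restrict hCX] at h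
  simpa [natRk, restrict_eRk_eq', Set.inter_eq_self_of_subset_left hCX] using h

/-- The flats containing `C` are the flats of `M ／ C` enlarged by `C`, with rank shifted by the rank
of `C`. -/
theorem sum_flats_superset (M : Matroid α) [M.Finite] {C : Set α} (hC : C ⊆ M.E) :
    open Classical in
    ∑ F ∈ M.flats with C ⊆ F, X ^ M.natRk F * (M ／ F).klPoly =
      X ^ M.natRk C * (M ／ C).zPoly := by
  classical
  rw [zPoly, Finset.mul_sum]
  refine Finset.sum_nbij' (fun F => F \ C) (fun F => F ∪ C) ?_ ?_ ?_ ?_ ?_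
  · intro F hF
    rw [Finset.mem_filter, mem_flats] at hF
    exact mem_flats.2 (hF.1.sdiff_contract hF.2)
  · intro F hF
    rw [mem_flats, isFlat_contract_iff hC] at hF
    exact Finset.mem_filter.2 ⟨mem_flats.2 hF.2, Set.subset_union_right⟩
  · intro F hF
    exact Set.sdiff_union_of_subset (Finset.mem_filter.1 hF).2
  · intro F hF
    rw [mem_flats, isFlat_contract_iff hC] at hF
    simp only [Set.union_sdiff_right]
    exact hF.1.sdiff_eq_left
  · intro F hF
    rw [Finset.mem_filter, mem_flats] at hF
    rw [← natRk_add_natRk_contract hF.2 hF.1.subset_ground, pow_add, mul_assoc]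
    congr 2
    refine klPoly_congr ?_
    rw [contract_contract, Set.union_sdiff_cancel hF.2]

/-! ### Dependence on the lattice of flats only. -/

/-- `σ` maps the ground set of `K` onto that of `N` and identifies the closure operators, so that
`K` and `N` have isomorphic lattices of flats. -/
structure IsClosureMap (K : Matroid α) (N : Matroid β) (σ : α → β) : Prop where
  image_ground : σ '' K.E = N.E
  mem_closure_iff : ∀ X ⊆ K.E, ∀ x ∈ K.E, x ∈ K.closure X ↔ σ x ∈ N.closure (σ '' X)

namespace IsClosureMap

variable {K : Matroid α} {N : Matroid β} {σ : α → β}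

theorem image_subset (h : IsClosureMap K N σ) {X : Set α} (hX : X ⊆ K.E) : σ '' X ⊆ N.E :=
  h.image_ground ▸ Set.image_mono hX

/-- `σ` may identify parallel elements, but it is injective on an independent set: if `x` shared its
image with another member `y`, then `x` would lie in the closure of the members other than `x`. So a
basis of `X` maps bijectively to a basis of the image. -/
theorem natRk_image (h : IsClosureMap K N σ) {X : Set α} (hX : X ⊆ K.E) :
    N.natRk (σ '' X) = K.natRk X := by
  obtain ⟨I, hI⟩ := K.exists_isBasis X
  have hIE := hI.indep.subset_ground
  have hne : ∀ x ∈ I, σ x ∉ N.closure (σ '' (I \ {x})) := fun x hx hσ =>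
    hI.indep.notMem_closure_sdiff_of_mem hx
      ((h.mem_closure_iff _ (Set.sdiff_subset.trans hIE) x (hIE hx)).2 hσ)
  have hinj : Set.InjOn σ I := by
    intro x hx y hy hxy
    by_contra hne'
    refine hne x hx (N.mem_closure_of_mem ?_ (h.image_subset (Set.sdiff_subset.trans hIE)))
    exact ⟨y, ⟨hy, fun h' => hne' h'.symm⟩, hxy.symm⟩
  have hind : N.Indep (σ '' I) := by
    rw [indep_iff_forall_notMem_closure_sdiff (h.image_subset hIE)]
    rintro _ ⟨x, hx, rfl⟩ hσ
    refine hne x hx (N.closure_subset_closure ?_ hσ)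
    rintro _ ⟨⟨y, hy, rfl⟩, hyx⟩
    exact ⟨y, ⟨hy, fun h' => hyx (congrArg σ h')⟩, rfl⟩
  have hB : N.IsBasis (σ '' I) (σ '' X) := by
    rw [isBasis_iff_indep_subset_closure]
    refine ⟨hind, Set.image_mono hI.subset, ?_⟩
    rintro _ ⟨x, hx, rfl⟩
    exact (h.mem_closure_iff I hIE x (hX hx)).1 (hI.subset_closure hx)
  rw [natRk, natRk, hB.eRk_eq_encard, hI.eRk_eq_encard, hinj.encard_image]

theorem image_preimage (h : IsClosureMap K N σ) {Y : Set β} (hY : Y ⊆ N.E) :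
    σ '' (K.E ∩ σ ⁻¹' Y) = Y := by
  rw [Set.image_inter_preimage, h.image_ground, Set.inter_eq_self_of_subset_right hY]

theorem isFlat_preimage (h : IsClosureMap K N σ) {F : Set β} (hF : N.IsFlat F) :
    K.IsFlat (K.E ∩ σ ⁻¹' F) := by
  rw [isFlat_iff_closure_eq]
  refine Set.Subset.antisymm (fun x hx => ?_) (K.subset_closure _ Set.inter_subset_left)
  have hxE := K.closure_subset_ground _ hx
  refine ⟨hxE, ?_⟩
  rw [h.mem_closure_iff _ Set.inter_subset_left x hxE, h.image_preimage hF.subset_ground,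
    hF.closure] at hx
  exact hx

theorem preimage_image (h : IsClosureMap K N σ) {F : Set α} (hF : K.IsFlat F) :
    K.E ∩ σ ⁻¹' (σ '' F) = F := by
  refine Set.Subset.antisymm ?_ fun x hx => ⟨hF.subset_ground hx, x, hx, rfl⟩
  rintro x ⟨hx, hxF⟩
  rw [← hF.closure, h.mem_closure_iff F hF.subset_ground x hx]
  exact N.mem_closure_of_mem hxF (h.image_subset hF.subset_ground)

theorem isFlat_image (h : IsClosureMap K N σ) {F : Set α} (hF : K.IsFlat F) :
    N.IsFlat (σ '' F) := by
  rw [isFlat_iff_closure_eq]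
  refine Set.Subset.antisymm (fun y hy => ?_) (N.subset_closure _ (h.image_subset hF.subset_ground))
  have hyE := N.closure_subset_ground _ hy
  rw [← h.image_ground] at hyE
  obtain ⟨x, hx, rfl⟩ := hyE
  rw [← h.mem_closure_iff F hF.subset_ground x hx, hF.closure] at hy
  exact ⟨x, hy, rfl⟩

theorem contract (h : IsClosureMap K N σ) {F : Set α} (hF : K.IsFlat F) :
    IsClosureMap (K ／ F) (N ／ (σ '' F)) σ := by
  have hmem : ∀ x ∈ K.E, σ x ∈ σ '' F ↔ x ∈ F := fun x hx =>
    ⟨fun hσ => h.preimage_image hF ▸ ⟨hx, hσ⟩, fun hx => ⟨x, hx, rfl⟩⟩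
  constructor
  · rw [contract_ground, contract_ground, ← h.image_ground]
    ext y
    constructor
    · rintro ⟨x, ⟨hx, hxF⟩, rfl⟩
      exact ⟨⟨x, hx, rfl⟩, fun hσ => hxF ((hmem x hx).1 hσ)⟩
    · rintro ⟨⟨x, hx, rfl⟩, hxF⟩
      exact ⟨x, ⟨hx, fun hxF' => hxF ⟨x, hxF', rfl⟩⟩, rfl⟩
  · intro X hX x hx
    rw [contract_closure_eq, contract_closure_eq, ← Set.image_union, Set.mem_sdiff, Set.mem_sdiff,
      hmem x hx.1, h.mem_closure_iff _ (Set.union_subset (hX.trans Set.sdiff_subset)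
        hF.subset_ground) x hx.1]

theorem natRank_eq (h : IsClosureMap K N σ) : K.natRank = N.natRank := by
  rw [natRank, natRank, ← h.natRk_image subset_rfl, h.image_ground]

end IsClosureMap

/-- Matroids with isomorphic lattices of flats have the same Kazhdan–Lusztig polynomial. -/
theorem IsClosureMap.klPoly_eq {K : Matroid α} {N : Matroid β} [K.Finite] [N.Finite] {σ : α → β}
    (h : IsClosureMap K N σ) : K.klPoly = N.klPoly := by
  induction hn : K.E.ncard using Nat.strong_induction_on generalizing K N with
  | _ n ih =>
    subst hn
    have hrank := h.natRank_eq
    by_cases h0 : K.natRank = 0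
    · rw [klPoly_of_natRank_eq_zero h0, klPoly_of_natRank_eq_zero (hrank ▸ h0)]
    -- Image and preimage are inverse bijections between flats, they preserve rank, and `σ` is again
    -- a closure map on the contractions, which are smaller.
    · have hsum : ∑ F ∈ K.posFlats, X ^ K.natRk F * (K ／ F).klPoly =
          ∑ F ∈ N.posFlats, X ^ N.natRk F * (N ／ F).klPoly := by
        refine Finset.sum_nbij' (fun F => σ '' F) (fun F => K.E ∩ σ ⁻¹' F) ?_ ?_ ?_ ?_ ?_
        · intro F hF
          rw [mem_posFlats] at hF ⊢
          rw [h.natRk_image hF.1.subset_ground]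
          exact ⟨h.isFlat_image hF.1, hF.2⟩
        · intro F hF
          rw [mem_posFlats] at hF ⊢
          rw [← h.natRk_image Set.inter_subset_left, h.image_preimage hF.1.subset_ground]
          exact ⟨h.isFlat_preimage hF.1, hF.2⟩
        · intro F hF
          exact h.preimage_image (mem_posFlats.1 hF).1
        · intro F hF
          exact h.image_preimage (mem_posFlats.1 hF).1.subset_ground
        · intro F hF
          have hF' := (mem_posFlats.1 hF).1
          rw [h.natRk_image hF'.subset_ground,
            ih _ (ncard_ground_contract_lt hF) (h.contract hF') rfl]
      ext k
      rw [coeff_klPoly h0, coeff_klPoly (hrank ▸ h0), hsum, hrank]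

/-- Deleting an element parallel to another one does not change the Kazhdan–Lusztig polynomial. -/
theorem klPoly_delete_of_parallel {M : Matroid α} [M.Finite] {e g : α} (hne : g ≠ e)
    (heg : e ∈ M.closure {g}) (hge : g ∈ M.closure {e}) : (M ＼ {e}).klPoly = M.klPoly := by
  classical
  have heE : e ∈ M.E := mem_ground_of_mem_closure heg
  have hgE : g ∈ M.E := mem_ground_of_mem_closure hge
  -- The retraction sending `e` to its parallel element `g` is a closure map from `M` to `M ＼ {e}`.
  let σ : α → α := fun x => if x = e then g else x
  have hσe : σ e = g := if_pos rfl
  have hσ : ∀ x, x ≠ e → σ x = x := fun x hx => if_neg hx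
  have hσne : ∀ x, σ x ≠ e := by
    intro x
    by_cases hx : x = e
    · rw [hx, hσe]
      exact hne
    · rw [hσ x hx]
      exact hx
  have hmem : ∀ Y, ∀ x, σ x ∈ M.closure Y ↔ x ∈ M.closure Y := by
    intro Y x
    by_cases hx : x = e
    · subst hx
      rw [hσe]
      constructor <;> intro h
      · exact M.closure_subset_closure_of_subset_closure (Set.singleton_subset_iff.2 h) heg
      · exact M.closure_subset_closure_of_subset_closure (Set.singleton_subset_iff.2 h) hge
    · rw [hσ x hx]
  refine (IsClosureMap.klPoly_eq (σ := σ) ⟨?_, ?_⟩).symm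
  · ext y
    constructor
    · rintro ⟨x, hx, rfl⟩
      refine ⟨?_, hσne x⟩
      by_cases hxe : x = e
      · rwa [hxe, hσe]
      · rwa [hσ x hxe]
    · rintro ⟨hy, hye⟩
      exact ⟨y, hy, hσ y hye⟩
  · intro Y hY x hx
    have hdisj : Disjoint (σ '' Y) {e} := by
      rw [Set.disjoint_singleton_right]
      rintro ⟨y, -, hy⟩
      exact hσne y hy
    have hcl : M.closure (σ '' Y) = M.closure Y := by
      refine Set.Subset.antisymm (M.closure_subset_closure_of_subset_closure ?_)
        (M.closure_subset_closure_of_subset_closure ?_)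
      · rintro _ ⟨y, hy, rfl⟩
        exact (hmem Y y).2 (M.mem_closure_of_mem hy)
      · intro y hy
        refine (hmem _ y).1 (M.mem_closure_of_mem' ⟨y, hy, rfl⟩ ?_)
        by_cases hye : y = e
        · rwa [hye, hσe]
        · rw [hσ y hye]
          exact hY hy
    rw [delete_closure_eq_of_disjoint _ hdisj, hcl, Set.mem_sdiff, hmem, Set.mem_singleton_iff,
      and_iff_left (hσne x)]

end Matroid

/-! ### Parallel classes that are coloops of the simplification. -/

namespace Matroid

open Polynomial

variable {α : Type*}

theorem two_mul_natDegree_klPoly_le (M : Matroid α) [M.Finite] :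
    2 * M.klPoly.natDegree ≤ M.natRank := by
  by_cases h : M.natRank = 0
  · simp [klPoly_of_natRank_eq_zero h]
  · exact (two_mul_natDegree_klPoly_lt h).le

theorem isFlat_empty (M : Matroid α) [M.Loopless] : M.IsFlat ∅ := by
  rw [← M.loops_eq_empty]
  exact isFlat_closure ∅

theorem mem_posFlats_of_nonempty {M : Matroid α} [M.Finite] [M.Loopless] {F : Set α}
    (hF : M.IsFlat F) (hne : F.Nonempty) : F ∈ M.posFlats :=
  mem_posFlats.2 ⟨hF, Nat.pos_of_ne_zero fun h0 =>
    hne.ne_empty ((natRk_eq_zero_iff hF.subset_ground).1 h0)⟩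

/-- `T` is a parallel class of `M` which forms a coloop of the simplification of `M`. -/
structure IsParallelColoop (M : Matroid α) (T : Set α) : Prop where
  nonempty : T.Nonempty
  subset_ground : T ⊆ M.E
  subset_closure : ∀ f ∈ T, T ⊆ M.closure {f}
  isFlat_compl : M.IsFlat (M.E \ T)

namespace IsParallelColoop

variable {M : Matroid α} {T F : Set α}

theorem disjoint_or_subset (h : M.IsParallelColoop T) (hF : M.IsFlat F) : Disjoint F T ∨ T ⊆ F := by
  rw [or_iff_not_imp_left, Set.not_disjoint_iff]
  rintro ⟨f, hfF, hfT⟩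
  refine (h.subset_closure f hfT).trans ?_
  rw [← hF.closure]
  exact M.closure_subset_closure (Set.singleton_subset_iff.2 hfF)

theorem closure_union_eq (h : M.IsParallelColoop T) {f : α} (hf : f ∈ T) :
    M.closure (F ∪ T) = M.closure (insert f F) := by
  have hcl : M.closure T = M.closure {f} :=
    Set.Subset.antisymm (M.closure_subset_closure_of_subset_closure (h.subset_closure f hf))
      (M.closure_subset_closure (Set.singleton_subset_iff.2 hf))
  rw [closure_union_congr_right hcl, Set.union_singleton]

theorem notMem_closure (h : M.IsParallelColoop T) (hF : F ⊆ M.E \ T) {f : α} (hf : f ∈ T) :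
    f ∉ M.closure F := fun hfF => by
  have := M.closure_subset_closure hF hfF
  rw [h.isFlat_compl.closure] at this
  exact this.2 hf

/-- If the closure of `F ∪ T` gained an element `x`, exchange would put some `f ∈ T` into the
closure of `insert x F`, which stays inside the flat `M.E \ T`. -/
theorem isFlat_union (h : M.IsParallelColoop T) (hF : M.IsFlat F) (hd : Disjoint F T) :
    M.IsFlat (F ∪ T) := by
  rw [isFlat_iff_closure_eq]
  refine Set.Subset.antisymm (fun x hx => ?_)
    (M.subset_closure _ (Set.union_subset hF.subset_ground h.subset_ground))
  have hxE := M.closure_subset_ground _ hx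
  by_contra hxn
  rw [Set.mem_union, not_or] at hxn
  obtain ⟨f, hf⟩ := h.nonempty
  rw [h.closure_union_eq hf] at hx
  have hxF : x ∉ M.closure F := by
    rw [hF.closure]
    exact hxn.1
  refine h.notMem_closure (F := insert x F) ?_ hf (closure_exchange ⟨hx, hxF⟩).1
  rintro y (rfl | hy)
  · exact ⟨hxE, hxn.2⟩
  · exact ⟨hF.subset_ground hy, Set.disjoint_left.1 hd hy⟩

theorem natRk_union [M.Finite] (h : M.IsParallelColoop T) (hF : F ⊆ M.E) (hd : Disjoint F T) :
    M.natRk (F ∪ T) = M.natRk F + 1 := by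
  obtain ⟨f, hf⟩ := h.nonempty
  rw [natRk_eq_of_closure_eq (h.closure_union_eq hf), natRk_insert (h.subset_ground hf)]
  exact h.notMem_closure (fun y hy => ⟨hF hy, Set.disjoint_left.1 hd hy⟩) hf

theorem isFlat_of_isFlat_union (h : M.IsParallelColoop T) (hd : Disjoint F T)
    (hF : M.IsFlat (F ∪ T)) : M.IsFlat F := by
  -- `F` is an intersection of two flats.
  have heq : F = (F ∪ T) ∩ (M.E \ T) := by
    ext x
    constructor
    · exact fun hx => ⟨Or.inl hx, hF.subset_ground (Or.inl hx), Set.disjoint_left.1 hd hx⟩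
    · rintro ⟨hx | hx, hx'⟩
      · exact hx
      · exact absurd hx hx'.2
  rw [heq, isFlat_iff_closure_eq]
  refine Set.Subset.antisymm (Set.subset_inter ?_ ?_)
    (M.subset_closure _ (Set.inter_subset_left.trans hF.subset_ground))
  · conv_rhs => rw [← hF.closure]
    exact M.closure_subset_closure Set.inter_subset_left
  · conv_rhs => rw [← h.isFlat_compl.closure]
    exact M.closure_subset_closure Set.inter_subset_right

theorem contract (h : M.IsParallelColoop T) (hF : F ⊆ M.E) (hd : Disjoint F T) :
    (M ／ F).IsParallelColoop T where
  nonempty := h.nonempty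
  subset_ground := fun x hx => ⟨h.subset_ground hx, fun hx' => Set.disjoint_left.1 hd hx' hx⟩
  subset_closure := fun f hf x hx => by
    rw [contract_closure_eq]
    exact ⟨M.closure_subset_closure Set.subset_union_left (h.subset_closure f hf hx),
      fun hx' => Set.disjoint_left.1 hd hx' hx⟩
  isFlat_compl := by
    have := h.isFlat_compl.sdiff_contract (C := F)
      fun x hx => ⟨hF hx, Set.disjoint_left.1 hd hx⟩
    rwa [sdiff_right_comm] at this

/-- Every flat is disjoint from `T` or contains it, and `F ↦ F ∪ T` matches the two kinds. The flats
containing `T` contribute `X * (M ／ T).zPoly`; the flats disjoint from `T` are the flats of `M ／ T`,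
with the same ranks. -/
theorem zPoly_sub [M.Finite] (h : M.IsParallelColoop T) :
    open Classical in
    M.zPoly - (1 + X) * (M ／ T).zPoly =
      ∑ F ∈ M.flats with Disjoint F T,
        X ^ M.natRk F * ((M ／ F).klPoly - (M ／ (F ∪ T)).klPoly) := by
  classical
  have hT : M.natRk T = 1 := by
    simpa [natRk] using h.natRk_union (Set.empty_subset _) (Set.empty_disjoint T)
  have hsup := M.sum_flats_superset h.subset_ground
  rw [hT, pow_one] at hsup
  have hz : M.zPoly = ∑ F ∈ M.flats with Disjoint F T, X ^ M.natRk F * (M ／ F).klPoly +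
      X * (M ／ T).zPoly := by
    rw [zPoly, ← Finset.sum_filter_add_sum_filter_not M.flats (fun F => Disjoint F T), ← hsup]
    congr 2
    refine Finset.filter_congr fun F hF => ?_
    constructor
    · exact fun hd => (h.disjoint_or_subset (mem_flats.1 hF)).resolve_left hd
    · intro hTF hd
      obtain ⟨f, hf⟩ := h.nonempty
      exact Set.disjoint_left.1 hd (hTF hf) hf
  have hu : ∑ F ∈ M.flats with Disjoint F T, X ^ M.natRk F * (M ／ (F ∪ T)).klPoly =
      (M ／ T).zPoly := by
    rw [zPoly]
    refine Finset.sum_congr ?_ ?_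
    · ext F
      rw [Finset.mem_filter, mem_flats, mem_flats, isFlat_contract_iff h.subset_ground]
      exact ⟨fun hF => ⟨hF.2, h.isFlat_union hF.1 hF.2⟩,
        fun hF => ⟨h.isFlat_of_isFlat_union hF.1 hF.2, hF.1⟩⟩
    · intro F hF
      rw [mem_flats, isFlat_contract_iff h.subset_ground] at hF
      have h1 := natRk_add_natRk_contract Set.subset_union_right hF.2.subset_ground
      rw [h.natRk_union (Set.subset_union_left.trans hF.2.subset_ground) hF.1, hT,
        Set.union_sdiff_right, hF.1.sdiff_eq_left] at h1
      rw [show (M ／ T).natRk F = M.natRk F by omega]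
      congr 1
      refine klPoly_congr ?_
      rw [contract_contract, Set.union_comm]
  simp only [mul_sub, Finset.sum_sub_distrib]
  rw [hz, hu]
  ring

/-- Contracting a coloop does not change the Kazhdan–Lusztig polynomial. -/
theorem klPoly_eq {M : Matroid α} [M.Finite] [M.Loopless] {T : Set α}
    (h : M.IsParallelColoop T) : M.klPoly = (M ／ T).klPoly := by
  classical
  induction hn : M.E.ncard using Nat.strong_induction_on generalizing M with
  | _ n ih =>
    subst hn
    have hflat : M.IsFlat T := by
      simpa using h.isFlat_union M.isFlat_empty (Set.empty_disjoint T)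
    have := hflat.contract_loopless
    have hT : M.natRk T = 1 := by
      simpa [natRk] using h.natRk_union (Set.empty_subset _) (Set.empty_disjoint T)
    have hrank := natRk_add_natRank_contract h.subset_ground
    have hz := h.zPoly_sub
    -- For `F ≠ ∅` the term vanishes by induction, since `T` keeps its property in `M ／ F`.
    rw [Finset.sum_eq_single_of_mem ∅
      (Finset.mem_filter.2 ⟨mem_flats.2 M.isFlat_empty, Set.empty_disjoint T⟩)] at hz
    · have h0 : M.zPoly - (1 + X) * (M ／ T).zPoly = M.klPoly - (M ／ T).klPoly := by
        rw [hz, klPoly_congr M.contract_empty, klPoly_congr (congrArg (M ／ ·) (Set.empty_union T))]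
        simp [natRk]
      have hpal := (M ／ T).isPalindromic_zPoly.one_add_X_mul
      rw [add_comm, ← hT, hrank] at hpal
      have hpal' := M.isPalindromic_zPoly.sub hpal
      rw [h0] at hpal'
      rw [← sub_eq_zero]
      refine hpal'.eq_zero ?_
      -- The weak bound suffices for `M ／ T`, whose rank is one less and possibly zero.
      have h1 := two_mul_natDegree_klPoly_lt (M := M) (by omega)
      have h2 := (M ／ T).two_mul_natDegree_klPoly_le
      have h3 := natDegree_sub_le M.klPoly (M ／ T).klPoly
      rcases le_max_iff.1 h3 with h4 | h4 <;> omega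
    · intro F hF hne
      rw [Finset.mem_filter, mem_flats] at hF
      have := hF.1.contract_loopless
      have hpos := mem_posFlats_of_nonempty hF.1 (Set.nonempty_iff_ne_empty.2 hne)
      rw [ih _ (ncard_ground_contract_lt hpos) (h.contract hF.1.subset_ground hF.2) rfl,
        klPoly_congr (M.contract_contract F T), sub_self, mul_zero]

end IsParallelColoop

/-! ### The deletion formula for `Z`-polynomials. -/

theorem natRk_delete (M : Matroid α) {X D : Set α} (hX : X ⊆ M.E) (hd : Disjoint X D) :
    (M ＼ D).natRk X = M.natRk X := by
  have hXD : X ⊆ M.E \ D := fun x hx => ⟨hX hx, Set.disjoint_left.1 hd hx⟩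
  rw [natRk, delete_eq_restrict, restrict_eRk_eq _ hXD, natRk]

/-- After contracting `F \ {e}` the element `e` is a loop, so deleting and contracting it agree. -/
theorem delete_contract_sdiff_of_mem_closure (M : Matroid α) {e : α} {F : Set α} (he : e ∈ F)
    (hcl : e ∈ M.closure (F \ {e})) : M ＼ {e} ／ (F \ {e}) = M ／ F := by
  conv_rhs => rw [← Set.sdiff_union_of_subset (Set.singleton_subset_iff.2 he), ← contract_contract]
  rw [contract_eq_delete_of_subset_loops (X := {e}), contract_delete_comm _ Set.disjoint_sdiff_left]
  rw [contract_loops_eq, Set.singleton_subset_iff]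
  exact ⟨hcl, fun h => h.2 rfl⟩

theorem IsFlat.closure_sdiff_singleton {M : Matroid α} {F : Set α} (hF : M.IsFlat F) {e : α}
    (he : ¬ (e ∈ F ∧ M.IsFlat (F \ {e}))) : M.closure (F \ {e}) = F := by
  by_cases heF : e ∈ F
  · have hsub : M.closure (F \ {e}) ⊆ F := by
      conv_rhs => rw [← hF.closure]
      exact M.closure_subset_closure Set.sdiff_subset
    have hsup := M.subset_closure (F \ {e}) (Set.sdiff_subset.trans hF.subset_ground)
    have hmem : e ∈ M.closure (F \ {e}) := by
      by_contra hn
      refine he ⟨heF, isFlat_iff_closure_eq.2 (Set.Subset.antisymm ?_ hsup)⟩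
      exact fun x hx => ⟨hsub hx, fun h => hn (h ▸ hx)⟩
    refine Set.Subset.antisymm hsub fun x hx => ?_
    by_cases hxe : x = e
    · exact hxe ▸ hmem
    · exact hsup ⟨hx, hxe⟩
  · rw [Set.sdiff_singleton_eq_self heF, hF.closure]

/-- If `e ∈ F`, then `e` is a loop once `F \ {e}` is contracted. If `e ∉ F`, the closure of `insert
e F` has a further element `g`, which is parallel to `e` in `M ／ F`. Deleting `e` is harmless in
both cases. -/
theorem klPoly_delete_contract_sdiff {M : Matroid α} [M.Finite] {e : α} (he : e ∈ M.E) {F : Set α}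
    (hF : M.IsFlat F) (h1 : ¬ (e ∈ F ∧ M.IsFlat (F \ {e})))
    (h2 : ¬ (e ∉ F ∧ M.IsFlat (insert e F))) :
    (M ＼ {e} ／ (F \ {e})).klPoly = (M ／ F).klPoly := by
  by_cases heF : e ∈ F
  · refine klPoly_congr (M.delete_contract_sdiff_of_mem_closure heF ?_)
    rwa [hF.closure_sdiff_singleton h1]
  · obtain ⟨g, hg, hgn⟩ : ∃ g ∈ M.closure (insert e F), g ∉ insert e F := by
      by_contra! hcon
      refine h2 ⟨heF, isFlat_iff_closure_eq.2 (Set.Subset.antisymm hcon ?_)⟩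
      exact M.subset_closure _ (Set.insert_subset he hF.subset_ground)
    rw [Set.mem_insert_iff, not_or] at hgn
    have heg := (closure_exchange ⟨hg, by rw [hF.closure]; exact hgn.2⟩).1
    have hpar := klPoly_delete_of_parallel (M := M ／ F) hgn.1
      (by rw [contract_closure_eq, Set.singleton_union]; exact ⟨heg, heF⟩)
      (by rw [contract_closure_eq, Set.singleton_union]; exact ⟨hg, hgn.2⟩)
    rw [← hpar]
    refine klPoly_congr ?_
    rw [Set.sdiff_singleton_eq_self heF,
      contract_delete_comm _ (Set.disjoint_singleton_right.2 heF)]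

/-- Closure in `M` embeds the flats of `M ＼ {e}` into those of `M`, preserving rank, with inverse `F
↦ F \ {e}`. The flats missed are those `F ∋ e` for which `F \ {e}` is itself a flat. -/
theorem zPoly_delete (M : Matroid α) [M.Finite] {e : α} :
    open Classical in
    (M ＼ {e}).zPoly = ∑ F ∈ M.flats with ¬ (e ∈ F ∧ M.IsFlat (F \ {e})),
      X ^ M.natRk F * (M ＼ {e} ／ (F \ {e})).klPoly := by
  classical
  have hcl : ∀ F, (M ＼ {e}).IsFlat F → e ∉ F ∧ M.closure F \ {e} = F := by
    intro F hF
    have heF : e ∉ F := fun h => (hF.subset_ground h).2 rfl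
    refine ⟨heF, ?_⟩
    rw [isFlat_iff_closure_eq, delete_closure_eq, Set.sdiff_singleton_eq_self heF] at hF
    exact hF
  rw [zPoly]
  refine Finset.sum_nbij' (fun F => M.closure F) (fun F => F \ {e}) ?_ ?_ ?_ ?_ ?_
  · intro F hF
    obtain ⟨heF, hF⟩ := hcl F (mem_flats.1 hF)
    rw [Finset.mem_filter, mem_flats]
    refine ⟨isFlat_closure F, fun h => ?_⟩
    rw [hF] at h
    exact heF (h.2.closure ▸ h.1)
  · intro F hF
    rw [Finset.mem_filter, mem_flats] at hF
    rw [mem_flats, isFlat_iff_closure_eq, delete_closure_eq, sdiff_idem,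
      hF.1.closure_sdiff_singleton hF.2]
  · intro F hF
    exact (hcl F (mem_flats.1 hF)).2
  · intro F hF
    rw [Finset.mem_filter, mem_flats] at hF
    exact hF.1.closure_sdiff_singleton hF.2
  · intro F hF
    obtain ⟨heF, hFcl⟩ := hcl F (mem_flats.1 hF)
    rw [natRk_delete M ((mem_flats.1 hF).subset_ground.trans Set.sdiff_subset)
      (Set.disjoint_singleton_right.2 heF), natRk_eq_of_closure_eq (M.closure_closure F).symm]
    congr 2
    rw [hFcl]

/-- The deletion formula for `Z`-polynomials. -/
theorem zPoly_sub_zPoly_delete (M : Matroid α) [M.Finite] {e : α} (he : e ∈ M.E) :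
    open Classical in
    M.zPoly - (M ＼ {e}).zPoly = ∑ F ∈ M.flats with e ∉ F ∧ M.IsFlat (insert e F),
      X ^ M.natRk F * ((M ／ F).klPoly - (M ＼ {e} ／ F).klPoly + X * (M ／ (insert e F)).klPoly) := by
  classical
  -- The flats of `M` with no counterpart in `M ＼ {e}` are reindexed by `F \ {e}`; the rank drop
  -- gives the extra factor `X`.
  have hB : ∑ F ∈ M.flats with e ∈ F ∧ M.IsFlat (F \ {e}), X ^ M.natRk F * (M ／ F).klPoly =
      ∑ F ∈ M.flats with e ∉ F ∧ M.IsFlat (insert e F),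
        X ^ M.natRk F * (X * (M ／ (insert e F)).klPoly) := by
    refine Finset.sum_nbij' (fun F => F \ {e}) (fun F => insert e F) ?_ ?_ ?_ ?_ ?_
    · intro F hF
      rw [Finset.mem_filter, mem_flats] at hF ⊢
      rw [Set.insert_sdiff_singleton, Set.insert_eq_of_mem hF.2.1]
      exact ⟨hF.2.2, fun h => h.2 rfl, hF.1⟩
    · intro F hF
      rw [Finset.mem_filter, mem_flats] at hF ⊢
      rw [Set.insert_sdiff_self_of_notMem hF.2.1]
      exact ⟨hF.2.2, Set.mem_insert _ _, hF.1⟩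
    · intro F hF
      rw [Finset.mem_filter] at hF
      simp only [Set.insert_sdiff_singleton]
      exact Set.insert_eq_of_mem hF.2.1
    · intro F hF
      rw [Finset.mem_filter] at hF
      exact Set.insert_sdiff_self_of_notMem hF.2.1
    · intro F hF
      rw [Finset.mem_filter, mem_flats] at hF
      have hF' : insert e (F \ {e}) = F := by
        rw [Set.insert_sdiff_singleton, Set.insert_eq_of_mem hF.2.1]
      have hrk := natRk_insert (X := F \ {e}) he (by rw [hF.2.2.closure]; exact fun h => h.2 rfl)
      rw [hF'] at hrk
      rw [hrk, pow_succ, mul_assoc, klPoly_congr (congrArg (M ／ ·) hF')]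
  -- Among matched flats, contraction polynomials can differ only if `e ∉ F` and `insert e F` is a
  -- flat.
  have hC : ∑ F ∈ M.flats with ¬ (e ∈ F ∧ M.IsFlat (F \ {e})),
        X ^ M.natRk F * ((M ／ F).klPoly - (M ＼ {e} ／ (F \ {e})).klPoly) =
      ∑ F ∈ M.flats with e ∉ F ∧ M.IsFlat (insert e F),
        X ^ M.natRk F * ((M ／ F).klPoly - (M ＼ {e} ／ F).klPoly) := by
    symm
    rw [Finset.sum_congr rfl (g := fun F =>
      X ^ M.natRk F * ((M ／ F).klPoly - (M ＼ {e} ／ (F \ {e})).klPoly))]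
    · refine Finset.sum_subset (fun F hF => ?_) fun F hF hF' => ?_
      · rw [Finset.mem_filter] at hF ⊢
        exact ⟨hF.1, fun h => hF.2.1 h.1⟩
      · rw [Finset.mem_filter, mem_flats] at hF
        rw [klPoly_delete_contract_sdiff he hF.1 hF.2, sub_self, mul_zero]
        exact fun h => hF' (Finset.mem_filter.2 ⟨mem_flats.2 hF.1, h⟩)
    · intro F hF
      rw [Finset.mem_filter] at hF
      rw [klPoly_congr (congrArg (M ＼ {e} ／ ·) (Set.sdiff_singleton_eq_self hF.2.1))]
  simp only [mul_add, Finset.sum_add_distrib]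
  rw [← hB, ← hC, zPoly_delete, zPoly,
    ← Finset.sum_filter_add_sum_filter_not M.flats (fun F => e ∈ F ∧ M.IsFlat (F \ {e}))]
  simp only [mul_sub, Finset.sum_sub_distrib]
  ring

/-! ### Glued triangles. -/

/-- `{e, f, g}` is a triangle, glued along `e` to the rest of the matroid, in which `e` is not a
coloop. -/
structure IsGluedTriangle (M : Matroid α) (e f g : α) : Prop where
  isFlat_compl : M.IsFlat (M.E \ {f, g})
  mem_closure : e ∈ M.closure {f, g}
  left_mem_closure : f ∈ M.closure {g, e}
  right_mem_closure : g ∈ M.closure {f, e}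
  mem_closure_compl : e ∈ M.closure (M.E \ {e, f, g})

namespace IsGluedTriangle

variable {M : Matroid α} {e f g : α}

theorem mem_ground (h : M.IsGluedTriangle e f g) : e ∈ M.E := mem_ground_of_mem_closure h.mem_closure

theorem left_mem_ground (h : M.IsGluedTriangle e f g) : f ∈ M.E :=
  mem_ground_of_mem_closure h.left_mem_closure

theorem right_mem_ground (h : M.IsGluedTriangle e f g) : g ∈ M.E :=
  mem_ground_of_mem_closure h.right_mem_closure

theorem notMem_pair (h : M.IsGluedTriangle e f g) : e ∉ ({f, g} : Set α) := by
  have hsub : M.E \ {e, f, g} ⊆ M.E \ {f, g} := Set.sdiff_subset_sdiff_right (Set.subset_insert _ _)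
  have := M.closure_subset_closure hsub h.mem_closure_compl
  rw [h.isFlat_compl.closure] at this
  exact this.2

theorem isParallelColoop_contract (h : M.IsGluedTriangle e f g) :
    (M ／ {e}).IsParallelColoop {f, g} := by
  have hn := h.notMem_pair
  have hf : f ≠ e := fun h' => hn (by simp [h'])
  have hg : g ≠ e := fun h' => hn (by simp [h'])
  refine ⟨Set.insert_nonempty _ _, ?_, ?_, ?_⟩
  · rintro x (rfl | rfl)
    · exact ⟨h.left_mem_ground, hf⟩
    · exact ⟨h.right_mem_ground, hg⟩
  · rintro x (rfl | rfl) y (rfl | rfl) <;> rw [contract_closure_eq, Set.singleton_union]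
    · exact ⟨M.mem_closure_of_mem' (Set.mem_insert _ _) h.left_mem_ground, hf⟩
    · exact ⟨h.right_mem_closure, hg⟩
    · exact ⟨h.left_mem_closure, hf⟩
    · exact ⟨M.mem_closure_of_mem' (Set.mem_insert _ _) h.right_mem_ground, hg⟩
  · have := h.isFlat_compl.sdiff_contract (C := {e})
      (Set.singleton_subset_iff.2 ⟨h.mem_ground, hn⟩)
    rwa [sdiff_right_comm] at this

/-- If `F` contained one of `f, g`, the flat `insert e F` would contain the other, hence so would
`F`, and then `e` would lie in the closure of `F`. This is what lets the triangle pass to `M ／ F`.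
-/
theorem disjoint_pair (h : M.IsGluedTriangle e f g) {F : Set α} (hF : M.IsFlat F) (he : e ∉ F)
    (hFe : M.IsFlat (insert e F)) : Disjoint F {f, g} := by
  have hn := h.notMem_pair
  have hf : f ≠ e := fun h' => hn (by simp [h'])
  have hg : g ≠ e := fun h' => hn (by simp [h'])
  have hcl : ∀ x ∈ F, ∀ y ≠ e, y ∈ M.closure {x, e} → y ∈ F := by
    intro x hx y hy hyx
    have hsub : {x, e} ⊆ insert e F := by
      rintro z (rfl | rfl)
      · exact Or.inr hx
      · exact Or.inl rfl
    have := M.closure_subset_closure hsub hyx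
    rw [hFe.closure] at this
    exact this.resolve_left hy
  have hpair : ¬ (f ∈ F ∧ g ∈ F) := by
    rintro ⟨h1, h2⟩
    refine he ?_
    rw [← hF.closure]
    exact M.closure_subset_closure (Set.insert_subset h1 (Set.singleton_subset_iff.2 h2))
      h.mem_closure
  rw [Set.disjoint_right]
  rintro x (rfl | rfl) hx
  · exact hpair ⟨hx, hcl _ hx g hg h.right_mem_closure⟩
  · exact hpair ⟨hcl _ hx f hf h.left_mem_closure, hx⟩

theorem contract (h : M.IsGluedTriangle e f g) {F : Set α} (hF : M.IsFlat F) (he : e ∉ F)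
    (hFe : M.IsFlat (insert e F)) : (M ／ F).IsGluedTriangle e f g := by
  have hd := h.disjoint_pair hF he hFe
  have hf : f ∉ F := fun h' => Set.disjoint_left.1 hd h' (by simp)
  have hg : g ∉ F := fun h' => Set.disjoint_left.1 hd h' (by simp)
  have key : ∀ x Y, x ∉ F → x ∈ M.closure Y → x ∈ (M ／ F).closure Y := by
    intro x Y hx hxY
    rw [contract_closure_eq]
    exact ⟨M.closure_subset_closure Set.subset_union_left hxY, hx⟩
  refine ⟨?_, key _ _ he h.mem_closure, key _ _ hf h.left_mem_closure,
    key _ _ hg h.right_mem_closure, ?_⟩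
  · have := h.isFlat_compl.sdiff_contract (C := F)
      fun x hx => ⟨hF.subset_ground hx, Set.disjoint_left.1 hd hx⟩
    rwa [sdiff_right_comm] at this
  · rw [contract_closure_eq, contract_ground]
    refine ⟨M.closure_subset_closure ?_ h.mem_closure_compl, he⟩
    intro x hx
    by_cases hxF : x ∈ F
    · exact Or.inr hxF
    · exact Or.inl ⟨⟨hx.1, hxF⟩, hx.2⟩

theorem natRank_delete (h : M.IsGluedTriangle e f g) : (M ＼ {e}).natRank = M.natRank := by
  rw [natRank, delete_ground, natRk_delete M Set.sdiff_subset Set.disjoint_sdiff_left]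
  refine natRk_eq_of_closure_eq (closure_sdiff_singleton_eq_closure ?_)
  exact M.closure_subset_closure (Set.sdiff_subset_sdiff_right (by simp)) h.mem_closure_compl

/-- The polynomial of `M ／ {e}` is that of `M ／ {e} ／ {f, g}`, of rank two less than `M`. This rank
is positive: otherwise nothing remains outside the triangle and `e` would be a loop. Hence `X * (M ／
{e}).klPoly` has degree below half the rank of `M`. -/
theorem two_mul_natDegree_klPoly_contract_lt [M.Finite] [M.Loopless] (h : M.IsGluedTriangle e f g)
    (he : M.IsFlat {e}) : 2 * (M ／ {e}).klPoly.natDegree + 2 < M.natRank := by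
  have hc := h.isParallelColoop_contract
  have := he.contract_loopless
  rw [hc.klPoly_eq]
  have hflat : (M ／ {e}).IsFlat {f, g} := by
    simpa using hc.isFlat_union (M ／ {e}).isFlat_empty (Set.empty_disjoint _)
  have := hflat.contract_loopless
  have hrk : (M ／ {e}).natRk {f, g} = 1 := by
    simpa [natRk] using hc.natRk_union (Set.empty_subset _) (Set.empty_disjoint _)
  have hrke : M.natRk {e} = 1 := by
    rw [natRk, eRk_singleton_eq h.mem_ground]
    rfl
  have h1 := natRk_add_natRank_contract (Set.singleton_subset_iff.2 h.mem_ground)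
  have h2 := natRk_add_natRank_contract hc.subset_ground
  have hpos : (M ／ {e} ／ {f, g}).natRank ≠ 0 := by
    rw [natRank, Ne, natRk_eq_zero_iff subset_rfl]
    intro hE
    have hE' : M.E \ {e, f, g} = ∅ := by
      rw [← hE, contract_ground, contract_ground, Set.sdiff_sdiff, Set.singleton_union]
    have := h.mem_closure_compl
    rw [hE', M.isFlat_empty.closure] at this
    exact this
  have h3 := two_mul_natDegree_klPoly_lt hpos
  omega

/-- The deletion formula for the Kazhdan–Lusztig polynomial of a matroid with a glued triangle. -/
theorem klPoly_eq [M.Finite] [M.Loopless] (h : M.IsGluedTriangle e f g) (he : M.IsFlat {e}) :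
    M.klPoly = (M ＼ {e}).klPoly - X * (M ／ {e}).klPoly := by
  classical
  induction hn : M.E.ncard using Nat.strong_induction_on generalizing M with
  | _ n ih =>
    subst hn
    have : (M ＼ {e}).Loopless := by
      rw [loopless_iff, delete_loops_eq, M.loops_eq_empty, Set.empty_sdiff]
    have hz := M.zPoly_sub_zPoly_delete h.mem_ground
    -- The bracket at a flat `F ≠ ∅` is the claimed identity for `M ／ F`, known by induction.
    rw [Finset.sum_eq_single_of_mem ∅ (Finset.mem_filter.2
      ⟨mem_flats.2 M.isFlat_empty, Set.notMem_empty e, by rwa [insert_empty_eq]⟩)] at hz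
    · have hpal := M.isPalindromic_zPoly.sub (h.natRank_delete ▸ (M ＼ {e}).isPalindromic_zPoly)
      rw [hz, klPoly_congr M.contract_empty, klPoly_congr (M ＼ {e}).contract_empty,
        klPoly_congr (congrArg (M ／ ·) (insert_empty_eq e)), natRk, eRk_empty, ENat.toNat_zero,
        pow_zero, one_mul] at hpal
      rw [← sub_eq_zero, ← sub_add]
      refine hpal.eq_zero ?_
      have h0 := h.two_mul_natDegree_klPoly_contract_lt he
      have h1 := two_mul_natDegree_klPoly_lt (M := M) (by omega)
      have h2 := two_mul_natDegree_klPoly_lt (M := M ＼ {e}) (by rw [h.natRank_delete]; omega)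
      rw [h.natRank_delete] at h2
      have h3 := natDegree_sub_le M.klPoly (M ＼ {e}).klPoly
      have h4 := natDegree_add_le (M.klPoly - (M ＼ {e}).klPoly) (X * (M ／ {e}).klPoly)
      have h5 := natDegree_mul_le (p := X) (q := (M ／ {e}).klPoly)
      rw [natDegree_X] at h5
      rcases le_max_iff.1 h3 with h6 | h6 <;> rcases le_max_iff.1 h4 with h7 | h7 <;> omega
    · intro F hF hne
      rw [Finset.mem_filter, mem_flats] at hF
      obtain ⟨hF, heF, hFe⟩ := hF
      have := hF.contract_loopless
      have hpos := mem_posFlats_of_nonempty hF (Set.nonempty_iff_ne_empty.2 hne)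
      have hrec := ih _ (ncard_ground_contract_lt hpos) (h.contract hF heF hFe)
        (by
          rw [isFlat_contract_iff hF.subset_ground, Set.singleton_union]
          exact ⟨Set.disjoint_singleton_left.2 heF, hFe⟩) rfl
      rw [klPoly_congr (M.contract_contract F {e}),
        klPoly_congr (congrArg (M ／ ·) Set.union_singleton),
        klPoly_congr (M.contract_delete_comm (Set.disjoint_singleton_right.2 heF))] at hrec
      rw [hrec]
      ring

end IsGluedTriangle

end Matroid

/-! ### Closure, deletion and contraction in graphic matroids. -/

namespace SimpleGraph

open scoped Matroid

variable {V W : Type*}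

theorem Reachable.map_eq {G : SimpleGraph V} {φ : V → W} (hφ : ∀ u v, G.Adj u v → φ u = φ v)
    {u v : V} (h : G.Reachable u v) : φ u = φ v := by
  obtain ⟨p⟩ := h
  induction p with
  | nil => rfl
  | cons h _ ih => exact (hφ _ _ h).trans ih

theorem Reachable.of_forall_adj {G H : SimpleGraph V} (hGH : ∀ u v, G.Adj u v → H.Reachable u v)
    {u v : V} (h : G.Reachable u v) : H.Reachable u v := by
  obtain ⟨p⟩ := h
  induction p with
  | nil => exact Reachable.refl _
  | cons h _ ih => exact (hGH _ _ h).trans ih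

theorem reachable_fromEdgeSet_of_mem {X : Set (Sym2 V)} {u v : V} (h : s(u, v) ∈ X) :
    (fromEdgeSet X).Reachable u v := by
  by_cases huv : u = v
  · rw [huv]
  · exact Adj.reachable ((fromEdgeSet_adj X).2 ⟨h, huv⟩)

section Finite

variable [Finite V] [Finite W]

/-- Adding an edge to a forest closes a cycle, or repeats an edge, exactly when its ends are already
connected. -/
theorem mem_closure_graphicMatroid_iff_of_indep {G : SimpleGraph V} {I : Set (Sym2 V)}
    (hI : G.graphicMatroid.Indep I) {u v : V} (huv : G.Adj u v) :
    s(u, v) ∈ G.graphicMatroid.closure I ↔ (fromEdgeSet I).Reachable u v := by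
  rw [hI.mem_closure_iff', and_iff_right (show s(u, v) ∈ G.graphicMatroid.E from huv),
    graphicMatroid_indep_iff, Set.insert_subset_iff, and_iff_left ((graphicMatroid_indep_iff G I).1 hI).1,
    and_iff_right (show s(u, v) ∈ G.edgeSet from huv), Set.insert_eq, Set.union_comm,
    fromEdgeSet_union, ← edge, isAcyclic_sup_fromEdgeSet_iff,
    and_iff_right ((graphicMatroid_indep_iff G I).1 hI).2]
  constructor
  · intro h
    by_contra hr
    exact hr (reachable_fromEdgeSet_of_mem (h fun hr' => absurd hr' hr))
  · exact fun hr h => ((fromEdgeSet_adj I).1 ((h hr).resolve_left huv.ne)).1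

theorem mem_closure_graphicMatroid_iff {G : SimpleGraph V} {X : Set (Sym2 V)}
    (hX : X ⊆ G.edgeSet) {u v : V} (huv : G.Adj u v) :
    s(u, v) ∈ G.graphicMatroid.closure X ↔ (fromEdgeSet X).Reachable u v := by
  obtain ⟨I, hI⟩ := G.graphicMatroid.exists_isBasis X hX
  rw [← hI.closure_eq_closure, mem_closure_graphicMatroid_iff_of_indep hI.indep huv]
  refine ⟨fun h => h.mono (fromEdgeSet_mono hI.subset), Reachable.of_forall_adj fun a b hab => ?_⟩
  rw [fromEdgeSet_adj] at hab
  exact (mem_closure_graphicMatroid_iff_of_indep hI.indep (hX hab.1)).1 (hI.subset_closure hab.1)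

theorem isFlat_graphicMatroid {G : SimpleGraph V} {X : Set (Sym2 V)} (hX : X ⊆ G.edgeSet)
    (h : ∀ u v, G.Adj u v → (fromEdgeSet X).Reachable u v → s(u, v) ∈ X) :
    G.graphicMatroid.IsFlat X := by
  rw [Matroid.isFlat_iff_closure_eq]
  refine Set.Subset.antisymm (fun x hx => ?_) (G.graphicMatroid.subset_closure X hX)
  induction x using Sym2.ind with
  | _ u v =>
    have huv : G.Adj u v := G.graphicMatroid.closure_subset_ground X hx
    exact h u v huv ((mem_closure_graphicMatroid_iff hX huv).1 hx)

instance (G : SimpleGraph V) : G.graphicMatroid.Loopless := by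
  rw [Matroid.loopless_iff, Matroid.loops]
  refine Matroid.IsFlat.closure (isFlat_graphicMatroid (Set.empty_subset _) fun u v huv h => ?_)
  rw [fromEdgeSet_empty, reachable_bot] at h
  exact absurd h huv.ne

theorem isFlat_graphicMatroid_singleton {G : SimpleGraph V} {a b : V} (hab : G.Adj a b) :
    G.graphicMatroid.IsFlat {s(a, b)} := by
  classical
  refine isFlat_graphicMatroid (Set.singleton_subset_iff.2 hab) fun u v huv h => ?_
  -- Merging `b` into `a` gives a function constant on components, whose fibres show that only `a`
  -- and `b` are joined.
  have hφ := h.map_eq (φ := fun z => if z = b then a else z) fun x y hxy => by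
    rw [fromEdgeSet_adj, Set.mem_singleton_iff, Sym2.eq_iff] at hxy
    obtain ⟨⟨rfl, rfl⟩ | ⟨rfl, rfl⟩, hne⟩ := hxy <;> simp
  have hne := huv.ne
  rw [Set.mem_singleton_iff, Sym2.eq_iff]
  split_ifs at hφ with h1 h2 h2
  · exact absurd (h1.trans h2.symm) hne
  · exact Or.inr ⟨h1, hφ.symm⟩
  · exact Or.inl ⟨hφ, h2⟩
  · exact absurd hφ hne

theorem graphicMatroid_deleteEdges (G : SimpleGraph V) (e : Sym2 V) :
    (G.deleteEdges {e}).graphicMatroid = G.graphicMatroid ＼ {e} := by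
  refine Matroid.ext_indep ?_ fun I _ => ?_
  · rw [graphicMatroid_ground, edgeSet_deleteEdges, Matroid.delete_ground, graphicMatroid_ground]
  · rw [Matroid.deleteElem_indep_iff, graphicMatroid_indep_iff, graphicMatroid_indep_iff,
      edgeSet_deleteEdges, Set.subset_sdiff, Set.disjoint_singleton_right]
    tauto

/-- Contracting the edge set `F` of `G` to obtain the vertices of `H` yields a matroid whose
simplification is the graphic matroid of `H`. -/
theorem klPoly_contract_eq {G : SimpleGraph V} {H : SimpleGraph W} {F : Set (Sym2 V)} (φ : V → W)
    (hFE : F ⊆ G.edgeSet) (hF : ∀ u v, φ u = φ v ↔ (fromEdgeSet F).Reachable u v)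
    (hadj : ∀ u v, G.Adj u v → s(u, v) ∉ F → H.Adj (φ u) (φ v))
    (hsurj : ∀ a b, H.Adj a b → ∃ u v, G.Adj u v ∧ φ u = a ∧ φ v = b) :
    (G.graphicMatroid ／ F).klPoly = H.klPoly := by
  have hmem : ∀ u v, s(u, v) ∈ F → φ u = φ v := fun u v huv =>
    (hF u v).2 (reachable_fromEdgeSet_of_mem huv)
  refine Matroid.IsClosureMap.klPoly_eq (σ := Sym2.map φ) ⟨?_, ?_⟩
  · rw [Matroid.contract_ground, graphicMatroid_ground, graphicMatroid_ground]
    ext y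
    induction y using Sym2.ind with
    | _ a b =>
      constructor
      · rintro ⟨x, ⟨hx, hxF⟩, hxy⟩
        induction x using Sym2.ind with
        | _ u v =>
          rw [← hxy]
          exact hadj u v hx hxF
      · intro hab
        obtain ⟨u, v, huv, rfl, rfl⟩ := hsurj a b hab
        exact ⟨s(u, v), ⟨huv, fun h => H.ne_of_adj hab (hmem u v h)⟩, rfl⟩
  · intro X hX x hx
    induction x using Sym2.ind with
    | _ u v =>
      rw [Matroid.contract_ground, graphicMatroid_ground] at hX hx
      have hXH : Sym2.map φ '' X ⊆ H.edgeSet := by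
        rintro _ ⟨y, hy, rfl⟩
        induction y using Sym2.ind with
        | _ a b => exact hadj a b (hX hy).1 (hX hy).2
      rw [Matroid.contract_closure_eq, Set.mem_sdiff, and_iff_left hx.2,
        mem_closure_graphicMatroid_iff (u := u) (v := v)
          (Set.union_subset (hX.trans Set.sdiff_subset) hFE) hx.1,
        show Sym2.map φ s(u, v) = s(φ u, φ v) from rfl,
        mem_closure_graphicMatroid_iff hXH (hadj u v hx.1 hx.2)]
      constructor
      · rintro ⟨p⟩
        clear hx
        induction p with
        | nil => exact Reachable.refl _
        | @cons a b _ hab _ ih =>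
          refine Reachable.trans ?_ ih
          obtain ⟨hab | hab, -⟩ := (fromEdgeSet_adj _).1 hab
          · exact reachable_fromEdgeSet_of_mem ⟨s(a, b), hab, rfl⟩
          · rw [hmem a b hab]
      · rintro ⟨p⟩
        clear hx
        -- A walk in the quotient lifts edge by edge through `X`; consecutive lifts meet in a common
        -- fibre of `φ`, which is connected by `F`. The lifted ends are arbitrary so that the
        -- induction goes through.
        have key : ∀ {a b : W}, (fromEdgeSet (Sym2.map φ '' X)).Walk a b → ∀ u v, φ u = a →
            φ v = b → (fromEdgeSet (X ∪ F)).Reachable u v := by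
          intro a b p
          induction p with
          | nil =>
            intro u v hu hv
            exact ((hF u v).1 (hu.trans hv.symm)).mono (fromEdgeSet_mono Set.subset_union_right)
          | @cons a c _ hac _ ih =>
            intro u v hu hv
            obtain ⟨⟨x, hx, hxac⟩, -⟩ := (fromEdgeSet_adj _).1 hac
            obtain ⟨u', c', hx', hu', hc'⟩ : ∃ u' c', s(u', c') ∈ X ∧ φ u' = a ∧ φ c' = c := by
              induction x using Sym2.ind with
              | _ y z =>
                rw [Sym2.map_mk, Sym2.eq_iff] at hxac
                obtain ⟨h1, h2⟩ | ⟨h1, h2⟩ := hxac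
                · exact ⟨y, z, hx, h1, h2⟩
                · exact ⟨z, y, Sym2.eq_swap ▸ hx, h2, h1⟩
            have h1 : (fromEdgeSet (X ∪ F)).Reachable u u' :=
              ((hF u u').1 (hu.trans hu'.symm)).mono (fromEdgeSet_mono Set.subset_union_right)
            exact (h1.trans (reachable_fromEdgeSet_of_mem (Or.inl hx'))).trans (ih c' v hc' hv)
        exact key p u v rfl rfl

theorem Iso.klPoly_eq {G : SimpleGraph V} {H : SimpleGraph W} (f : G ≃g H) :
    G.klPoly = H.klPoly := by
  rw [← klPoly_contract_eq (F := ∅) f (Set.empty_subset _)]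
  · exact Matroid.klPoly_congr G.graphicMatroid.contract_empty.symm
  · intro u v
    rw [fromEdgeSet_empty, reachable_bot, f.injective.eq_iff]
  · exact fun u v huv _ => f.map_adj_iff.2 huv
  · intro a b hab
    exact ⟨f.symm a, f.symm b, f.symm.map_adj_iff.2 hab, f.apply_symm_apply a, f.apply_symm_apply b⟩

/-- The deletion formula for a graph in which a triangle with tip `c` is glued along an edge `{a, b}`
which is not a bridge of the rest of the graph. -/
theorem klPoly_eq_of_glued_triangle {G : SimpleGraph V} {a b c : V} (hab : G.Adj a b)
    (hc : ∀ x, G.Adj c x ↔ x = a ∨ x = b)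
    (hr : (fromEdgeSet (G.edgeSet \ {s(a, b), s(a, c), s(b, c)})).Reachable a b) :
    G.klPoly = (G.deleteEdges {s(a, b)}).klPoly -
      Polynomial.X * (G.graphicMatroid ／ {s(a, b), s(a, c), s(b, c)}).klPoly := by
  have hac : G.Adj a c := ((hc a).2 (Or.inl rfl)).symm
  have hbc : G.Adj b c := ((hc b).2 (Or.inr rfl)).symm
  have hpair : ∀ x ∈ G.edgeSet, ∀ y ∈ G.edgeSet, ({x, y} : Set (Sym2 V)) ⊆ G.edgeSet :=
    fun x hx y hy => Set.insert_subset hx (Set.singleton_subset_iff.2 hy)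
  have hG : G.graphicMatroid.IsGluedTriangle s(a, b) s(a, c) s(b, c) := by
    constructor
    · refine isFlat_graphicMatroid Set.sdiff_subset fun u v huv h => ⟨huv, ?_⟩
      -- Without its two edges the tip `c` is isolated.
      have hφ := h.map_eq (φ := fun z => z = c) fun x y hadj => by
        obtain ⟨⟨hxy, hn⟩, -⟩ := (fromEdgeSet_adj _).1 hadj
        change G.Adj x y at hxy
        have hx : x ≠ c := by
          rintro rfl
          obtain rfl | rfl := (hc y).1 hxy <;> exact hn (by simp [Sym2.eq_swap])
        have hy : y ≠ c := by
          rintro rfl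
          obtain rfl | rfl := (hc x).1 hxy.symm <;> exact hn (by simp)
        simp [hx, hy]
      have huv' := huv.ne
      have hac' := hac.ne
      have hbc' := hbc.ne
      simp only [eq_iff_iff] at hφ
      simp only [Set.mem_insert_iff, Set.mem_singleton_iff, Sym2.eq_iff]
      grind
    · rw [mem_closure_graphicMatroid_iff (hpair _ hac _ hbc) hab]
      exact (reachable_fromEdgeSet_of_mem (v := c) (by simp)).trans
        (reachable_fromEdgeSet_of_mem (by simp [Sym2.eq_swap]))
    · rw [mem_closure_graphicMatroid_iff (hpair _ hbc _ hab) hac]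
      exact (reachable_fromEdgeSet_of_mem (v := b) (by simp)).trans
        (reachable_fromEdgeSet_of_mem (by simp))
    · rw [mem_closure_graphicMatroid_iff (hpair _ hac _ hab) hbc]
      exact (reachable_fromEdgeSet_of_mem (v := a) (by simp [Sym2.eq_swap])).trans
        (reachable_fromEdgeSet_of_mem (by simp))
    · rwa [graphicMatroid_ground, mem_closure_graphicMatroid_iff Set.sdiff_subset hab]
  have hflat := isFlat_graphicMatroid_singleton hab
  have := hflat.contract_loopless
  rw [klPoly, hG.klPoly_eq hflat, klPoly, Matroid.klPoly_congr (G.graphicMatroid_deleteEdges _),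
    hG.isParallelColoop_contract.klPoly_eq,
    Matroid.klPoly_congr (G.graphicMatroid.contract_contract _ _)]
  rfl

end Finite

end SimpleGraph

/-! ### Saw graphs: adjacency in terms of natural numbers, and rotation. -/

namespace SimpleGraph

open scoped Matroid

theorem cycleGraph_adj_iff_val {n : ℕ} {i j : Fin (n + 2)} :
    (cycleGraph (n + 2)).Adj i j ↔ j.val = i.val + 1 ∨ i.val = j.val + 1 ∨
      (i.val = n + 1 ∧ j.val = 0) ∨ (j.val = n + 1 ∧ i.val = 0) := by
  rw [cycleGraph_adj, sub_eq_iff_eq_add', sub_eq_iff_eq_add', Fin.ext_iff, Fin.ext_iff,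
    Fin.val_add_one, Fin.val_add_one]
  simp only [Fin.ext_iff, Fin.val_last]
  split_ifs <;> omega

theorem eq_finRotate_iff_val {n : ℕ} {i j : Fin (n + 1)} :
    j = finRotate (n + 1) i ↔ (j.val = i.val + 1 ∨ (i.val = n ∧ j.val = 0)) := by
  rw [finRotate_apply, Fin.ext_iff, Fin.val_add_one]
  simp only [Fin.ext_iff, Fin.val_last]
  split_ifs <;> omega

section sawGraph

variable {n : ℕ} {S : Finset (Fin (n + 2))}

theorem sawGraph_adj_inl_inl {i j : Fin (n + 2)} :
    (sawGraph (n + 2) S).Adj (.inl i) (.inl j) ↔ j.val = i.val + 1 ∨ i.val = j.val + 1 ∨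
      (i.val = n + 1 ∧ j.val = 0) ∨ (j.val = n + 1 ∧ i.val = 0) :=
  cycleGraph_adj_iff_val

theorem sawGraph_adj_inr_inl {i : S} {j : Fin (n + 2)} :
    (sawGraph (n + 2) S).Adj (.inr i) (.inl j) ↔
      j.val = i.1.val ∨ j.val = i.1.val + 1 ∨ (i.1.val = n + 1 ∧ j.val = 0) := by
  rw [← eq_finRotate_iff_val, ← Fin.ext_iff]
  rfl

theorem sawGraph_adj_inl_inr {i : S} {j : Fin (n + 2)} :
    (sawGraph (n + 2) S).Adj (.inl j) (.inr i) ↔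
      j.val = i.1.val ∨ j.val = i.1.val + 1 ∨ (i.1.val = n + 1 ∧ j.val = 0) := by
  rw [adj_comm, sawGraph_adj_inr_inl]

theorem sawGraph_adj_inr_inr {i j : S} : ¬ (sawGraph (n + 2) S).Adj (.inr i) (.inr j) := id

end sawGraph

/-- Rotating the cycle yields an isomorphic saw graph. -/
def sawGraphRotate (n : ℕ) (S : Finset (Fin (n + 2))) (c : Fin (n + 2)) :
    sawGraph (n + 2) S ≃g sawGraph (n + 2) (S.map (Equiv.addRight c).toEmbedding) where
  toEquiv := Equiv.sumCongr (Equiv.addRight c) ((Equiv.addRight c).subtypeEquiv fun a => by simp)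
  map_rel_iff' := by
    rintro (i | i) (j | j)
    · change (cycleGraph (n + 2)).Adj (i + c) (j + c) ↔ (cycleGraph (n + 2)).Adj i j
      rw [cycleGraph_adj, cycleGraph_adj, add_sub_add_right_eq_sub, add_sub_add_right_eq_sub]
    · change i + c = j.1 + c ∨ i + c = finRotate (n + 2) (j.1 + c) ↔
        i = j.1 ∨ i = finRotate (n + 2) j.1
      rw [finRotate_apply, finRotate_apply, add_right_comm, add_left_inj, add_left_inj]
    · change j + c = i.1 + c ∨ j + c = finRotate (n + 2) (i.1 + c) ↔
        j = i.1 ∨ j = finRotate (n + 2) i.1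
      rw [finRotate_apply, finRotate_apply, add_right_comm, add_left_inj, add_left_inj]
    · exact Iff.rfl

/-! ### The recursion for saw graphs. -/

section recursion

variable {m : ℕ} (T : Finset (Fin (m + 2)))

/-- The edges of the `(m + 3)`-cycle in `T`, together with the last edge. -/
def sawInsertLast : Finset (Fin (m + 3)) :=
  insert (Fin.last (m + 2)) (T.map Fin.castSuccEmb)

/-- The edges of the `(m + 4)`-cycle in `T`. -/
def sawLift : Finset (Fin (m + 4)) :=
  T.map (Fin.castSuccEmb.trans Fin.castSuccEmb)

variable {T}

theorem mem_sawInsertLast {i : Fin (m + 3)} :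
    i ∈ sawInsertLast T ↔ i.val = m + 2 ∨ ∃ t ∈ T, t.val = i.val := by
  simp [sawInsertLast, Fin.ext_iff]

theorem mem_sawLift {i : Fin (m + 4)} : i ∈ sawLift T ↔ ∃ t ∈ T, t.val = i.val := by
  simp [sawLift, Fin.ext_iff]

theorem card_sawInsertLast : (sawInsertLast T).card = T.card + 1 := by
  rw [sawInsertLast, Finset.card_insert_of_notMem, Finset.card_map]
  simp [Fin.ext_iff, (Fin.isLt _).ne]

theorem card_sawLift : (sawLift T).card = T.card := Finset.card_map _

theorem exists_sawInsertLast_eq {S : Finset (Fin (m + 3))} (h : Fin.last (m + 2) ∈ S) :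
    ∃ T, sawInsertLast T = S := by
  refine ⟨Finset.univ.filter fun t => t.castSucc ∈ S, ?_⟩
  ext i
  induction i using Fin.lastCases with
  | last => simp [mem_sawInsertLast, h]
  | cast i =>
    rw [mem_sawInsertLast]
    constructor
    · rintro (hi | ⟨t, ht, hi⟩)
      · exact absurd hi i.isLt.ne
      · obtain rfl : t = i := Fin.ext hi
        simpa using ht
    · exact fun hi => Or.inr ⟨i, by simpa using hi, rfl⟩

/-- The tip of the triangle glued along the last edge of the cycle. -/
def lastTip (T : Finset (Fin (m + 2))) : sawInsertLast T :=
  ⟨Fin.last (m + 2), Finset.mem_insert_self _ _⟩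

theorem lastTip_val : (lastTip T).1.val = m + 2 := rfl

/-- The vertices of the `(m + 4)`-cycle, the last of which is the tip at the last edge of the
`(m + 3)`-cycle, and the remaining tips. -/
def sawDeleteMap (T : Finset (Fin (m + 2))) :
    Fin (m + 4) ⊕ sawLift T → Fin (m + 3) ⊕ sawInsertLast T
  | .inl j => if h : j.val < m + 3 then .inl ⟨j.val, h⟩ else .inr (lastTip T)
  | .inr s => .inr ⟨⟨s.1.val, by
      obtain ⟨t, -, ht⟩ := mem_sawLift.1 s.2
      omega⟩, mem_sawInsertLast.2 (Or.inr (mem_sawLift.1 s.2))⟩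

theorem sawDeleteMap_bijective : Function.Bijective (sawDeleteMap T) := by
  have hlt : ∀ s : sawLift T, s.1.val < m + 2 := fun s => by
    obtain ⟨t, -, ht⟩ := mem_sawLift.1 s.2
    omega
  constructor
  · rintro (i | i) (j | j) h
    · simp only [sawDeleteMap] at h
      split_ifs at h with h1 h2 h2
      · simpa [Fin.ext_iff] using h
      · rw [Sum.inl.injEq, Fin.ext_iff]
        omega
    · simp only [sawDeleteMap] at h
      have := hlt j
      split_ifs at h with h1
      have h' := congrArg (fun s => s.1.val) (Sum.inr.inj h)
      simp only [lastTip_val] at h'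
      omega
    · simp only [sawDeleteMap] at h
      have := hlt i
      split_ifs at h with h1
      have h' := congrArg (fun s => s.1.val) (Sum.inr.inj h)
      simp only [lastTip_val] at h'
      omega
    · have h' := congrArg (fun s => s.1.val) (Sum.inr.inj h)
      exact congrArg Sum.inr (Subtype.ext (Fin.ext h'))
  · rintro (i | ⟨i, hi⟩)
    · refine ⟨.inl ⟨i.val, by omega⟩, ?_⟩
      simp [sawDeleteMap]
    · rcases mem_sawInsertLast.1 hi with h | ⟨t, ht, hti⟩
      · refine ⟨.inl (Fin.last _), ?_⟩
        obtain rfl : i = Fin.last _ := Fin.ext h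
        simp [sawDeleteMap, lastTip]
      · exact ⟨.inr ⟨⟨t.val, by omega⟩, mem_sawLift.2 ⟨t, ht, rfl⟩⟩, by simp [sawDeleteMap, hti]⟩

theorem sawDeleteMap_adj (u v : Fin (m + 4) ⊕ sawLift T) :
    ((sawGraph (m + 3) (sawInsertLast T)).deleteEdges {s(.inl (Fin.last _), .inl 0)}).Adj
      (sawDeleteMap T u) (sawDeleteMap T v) ↔ (sawGraph (m + 4) (sawLift T)).Adj u v := by
  have hlt : ∀ s : sawLift T, s.1.val < m + 2 := fun s => by
    obtain ⟨t, -, ht⟩ := mem_sawLift.1 s.2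
    omega
  rw [deleteEdges_adj, Set.mem_singleton_iff, Sym2.eq_iff]
  rcases u with i | i <;> rcases v with j | j <;> simp only [sawDeleteMap]
  · rw [sawGraph_adj_inl_inl (n := m + 2)]
    split_ifs with h1 h2 h2
    · rw [sawGraph_adj_inl_inl]
      simp only [Sum.inl.injEq, Fin.ext_iff, Fin.val_last, Fin.val_zero]
      omega
    · rw [sawGraph_adj_inl_inr]
      simp only [lastTip_val, and_false, or_false, not_false_eq_true, and_true,
        true_and]
      omega
    · rw [sawGraph_adj_inr_inl]
      simp only [lastTip_val, false_and, or_false, not_false_eq_true, and_true,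
        true_and]
      omega
    · simp only [sawGraph_adj_inr_inr, false_and, false_iff]
      omega
  · have := hlt j
    rw [sawGraph_adj_inl_inr (n := m + 2)]
    split_ifs with h1
    · rw [sawGraph_adj_inl_inr]
      simp only [and_false, or_false, not_false_eq_true, and_true]
      omega
    · simp only [sawGraph_adj_inr_inr, false_and, false_iff]
      omega
  · have := hlt i
    rw [sawGraph_adj_inr_inl (n := m + 2)]
    split_ifs with h1
    · rw [sawGraph_adj_inr_inl]
      simp only [false_and, or_false, not_false_eq_true, and_true]
      omega
    · simp only [sawGraph_adj_inr_inr, false_and, false_iff]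
      omega
  · simp only [sawGraph_adj_inr_inr, false_and]

/-- Deleting the last edge of the cycle, which carries a triangle, lengthens the cycle. -/
noncomputable def sawGraphDeleteIso (T : Finset (Fin (m + 2))) :
    sawGraph (m + 4) (sawLift T) ≃g
      (sawGraph (m + 3) (sawInsertLast T)).deleteEdges {s(.inl (Fin.last _), .inl 0)} where
  toEquiv := Equiv.ofBijective _ sawDeleteMap_bijective
  map_rel_iff' := sawDeleteMap_adj _ _

/-- The map which contracts the triangle at the last edge of the cycle to the vertex `0`. -/
def sawContractMap (T : Finset (Fin (m + 2))) :
    Fin (m + 3) ⊕ sawInsertLast T → Fin (m + 2) ⊕ T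
  | .inl j => if h : j.val < m + 2 then .inl ⟨j.val, h⟩ else .inl 0
  | .inr s => if h : s.1.val < m + 2 then .inr ⟨⟨s.1.val, h⟩, by
      obtain hs | ⟨t, ht, hts⟩ := mem_sawInsertLast.1 s.2
      · omega
      · rwa [show (⟨s.1.val, h⟩ : Fin (m + 2)) = t from Fin.ext hts.symm]⟩ else .inl 0

/-- The edges of the triangle at the last edge of the cycle. -/
def lastTriangle (T : Finset (Fin (m + 2))) : Set (Sym2 (Fin (m + 3) ⊕ sawInsertLast T)) :=
  {s(.inl (Fin.last _), .inl 0), s(.inl (Fin.last _), .inr (lastTip T)),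
    s(.inl 0, .inr (lastTip T))}

theorem sawContractMap_eq_iff (u v : Fin (m + 3) ⊕ sawInsertLast T) :
    sawContractMap T u = sawContractMap T v ↔ (fromEdgeSet (lastTriangle T)).Reachable u v := by
  constructor
  · intro h
    -- The fibre over `0` consists of the three vertices of the last triangle; all other fibres are
    -- singletons.
    have hcases : ∀ w, (sawContractMap T w = .inl 0 ∧
        (fromEdgeSet (lastTriangle T)).Reachable w (.inl 0)) ∨
        (∃ i : Fin (m + 3), i.val < m + 2 ∧ i.val ≠ 0 ∧ w = .inl i) ∨
        (∃ s : sawInsertLast T, s.1.val < m + 2 ∧ w = .inr s) := by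
      rintro (i | ⟨i, hi⟩)
      · by_cases h0 : i.val = 0
        · obtain rfl : i = 0 := Fin.ext h0
          exact Or.inl ⟨by simp [sawContractMap], Reachable.refl _⟩
        · by_cases h1 : i.val < m + 2
          · exact Or.inr (Or.inl ⟨i, h1, h0, rfl⟩)
          · obtain rfl : i = Fin.last _ := Fin.ext (by rw [Fin.val_last]; omega)
            exact Or.inl ⟨by simp [sawContractMap],
              reachable_fromEdgeSet_of_mem (by simp [lastTriangle])⟩
      · by_cases h1 : i.val < m + 2
        · exact Or.inr (Or.inr ⟨⟨i, hi⟩, h1, rfl⟩)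
        · obtain rfl : i = Fin.last _ := Fin.ext (by rw [Fin.val_last]; omega)
          exact Or.inl ⟨by simp [sawContractMap],
            (reachable_fromEdgeSet_of_mem (by simp [lastTriangle, lastTip])).symm⟩
    rcases hcases u with ⟨hu, hu'⟩ | ⟨i, hi, hi0, rfl⟩ | ⟨i, hi, rfl⟩ <;>
      rcases hcases v with ⟨hv, hv'⟩ | ⟨j, hj, hj0, rfl⟩ | ⟨j, hj, rfl⟩
    · exact hu'.trans hv'.symm
    · rw [hu] at h
      simp only [sawContractMap, hj, dif_pos, Sum.inl.injEq, Fin.ext_iff, Fin.val_zero] at h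
      exact absurd h.symm hj0
    · rw [hu] at h
      simp [sawContractMap, hj] at h
    · rw [hv] at h
      simp only [sawContractMap, hi, dif_pos, Sum.inl.injEq, Fin.ext_iff, Fin.val_zero] at h
      exact absurd h hi0
    · simp only [sawContractMap, hi, hj, dif_pos, Sum.inl.injEq, Fin.mk.injEq] at h
      rw [Fin.ext h]
    · simp [sawContractMap, hi, hj] at h
    · rw [hv] at h
      simp [sawContractMap, hi] at h
    · simp [sawContractMap, hi, hj] at h
    · simp only [sawContractMap, hi, hj, dif_pos, Sum.inr.injEq, Subtype.mk.injEq,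
        Fin.mk.injEq] at h
      rw [Subtype.ext (Fin.ext h)]
  · intro h
    refine h.map_eq fun x y hxy => ?_
    rw [fromEdgeSet_adj] at hxy
    simp only [lastTriangle, Set.mem_insert_iff, Set.mem_singleton_iff, Sym2.eq_iff] at hxy
    obtain ⟨(⟨rfl, rfl⟩ | ⟨rfl, rfl⟩) | (⟨rfl, rfl⟩ | ⟨rfl, rfl⟩) |
      (⟨rfl, rfl⟩ | ⟨rfl, rfl⟩), -⟩ := hxy <;>
      simp [sawContractMap, lastTip]

theorem sawContractMap_adj {u v : Fin (m + 3) ⊕ sawInsertLast T}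
    (huv : (sawGraph (m + 3) (sawInsertLast T)).Adj u v) (hn : s(u, v) ∉ lastTriangle T) :
    (sawGraph (m + 2) T).Adj (sawContractMap T u) (sawContractMap T v) := by
  have hlast : ∀ s : sawInsertLast T, ¬ s.1.val < m + 2 → s = lastTip T := fun s hs =>
    Subtype.ext (Fin.ext (by simp only [lastTip, Fin.val_last]; omega))
  have hinl : ∀ (i : Fin (m + 3)) (s : sawInsertLast T),
      (sawGraph (m + 3) (sawInsertLast T)).Adj (.inl i) (.inr s) →
      s(.inl i, .inr s) ∉ lastTriangle T →
      (sawGraph (m + 2) T).Adj (sawContractMap T (.inl i)) (sawContractMap T (.inr s)) := by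
    intro i s h hn
    rw [sawGraph_adj_inl_inr] at h
    by_cases hs : s.1.val < m + 2
    · simp only [sawContractMap, hs, dif_pos]
      split_ifs with hi <;> rw [sawGraph_adj_inl_inr] <;> simp only [Fin.val_zero, and_true] <;> omega
    · refine absurd ?_ hn
      obtain rfl := hlast s hs
      simp only [lastTip, Fin.val_last] at h
      obtain rfl | rfl : i = Fin.last _ ∨ i = 0 := by
        simp only [Fin.ext_iff, Fin.val_last, Fin.val_zero]
        omega
      · simp [lastTriangle]
      · simp [lastTriangle]
  rcases u with i | i <;> rcases v with j | j
  · rw [sawGraph_adj_inl_inl] at huv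
    have hn' : ¬ ((i.val = m + 2 ∧ j.val = 0) ∨ (i.val = 0 ∧ j.val = m + 2)) := by
      rintro (⟨h1, h2⟩ | ⟨h1, h2⟩)
      · obtain rfl : i = Fin.last _ := Fin.ext h1
        obtain rfl : j = 0 := Fin.ext h2
        exact hn (by simp [lastTriangle])
      · obtain rfl : i = 0 := Fin.ext h1
        obtain rfl : j = Fin.last _ := Fin.ext h2
        exact hn (by simp [lastTriangle])
    simp only [sawContractMap]
    split_ifs with hi hj hj <;> rw [sawGraph_adj_inl_inl] <;> simp only [Fin.val_zero, and_true] <;> omega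
  · exact hinl i j huv hn
  · exact (hinl j i huv.symm (by rwa [Sym2.eq_swap])).symm
  · exact absurd huv sawGraph_adj_inr_inr

theorem exists_adj_sawContractMap {a b : Fin (m + 2) ⊕ T} (hab : (sawGraph (m + 2) T).Adj a b) :
    ∃ u v, (sawGraph (m + 3) (sawInsertLast T)).Adj u v ∧
      sawContractMap T u = a ∧ sawContractMap T v = b := by
  have hφ : ∀ i : Fin (m + 2), sawContractMap T (.inl ⟨i.val, by omega⟩) = .inl i := fun i => by
    simp [sawContractMap]
  -- The second preimage of `0`, needed to lift edges from `m + 1` to `0` and the edge from the tip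
  -- over that edge to `0`.
  have hφ0 : ∀ i : Fin (m + 2), i.val = 0 →
      sawContractMap T (.inl ⟨m + 2, by omega⟩) = .inl i := fun i hi => by
    simp [sawContractMap, Fin.ext_iff, hi]
  have hψ : ∀ s : T, sawContractMap T
      (.inr ⟨⟨s.1.val, by omega⟩, mem_sawInsertLast.2 (Or.inr ⟨s.1, s.2, rfl⟩)⟩) = .inr s :=
    fun s => by simp [sawContractMap]
  have hinl : ∀ (i : Fin (m + 2)) (s : T), (sawGraph (m + 2) T).Adj (.inl i) (.inr s) →
      ∃ u v, (sawGraph (m + 3) (sawInsertLast T)).Adj u v ∧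
        sawContractMap T u = .inl i ∧ sawContractMap T v = .inr s := by
    intro i s h
    rw [sawGraph_adj_inl_inr] at h
    obtain h | h : (i.val = s.1.val ∨ i.val = s.1.val + 1) ∨ (s.1.val = m + 1 ∧ i.val = 0) := by
      omega
    · refine ⟨_, _, ?_, hφ i, hψ s⟩
      rw [sawGraph_adj_inl_inr]
      simp only
      omega
    · refine ⟨_, _, ?_, hφ0 i h.2, hψ s⟩
      rw [sawGraph_adj_inl_inr]
      simp only
      omega
  rcases a with i | i <;> rcases b with j | j
  · rw [sawGraph_adj_inl_inl] at hab
    obtain h | h | h : (j.val = i.val + 1 ∨ i.val = j.val + 1) ∨ (i.val = m + 1 ∧ j.val = 0) ∨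
      (j.val = m + 1 ∧ i.val = 0) := by omega
    · refine ⟨_, _, ?_, hφ i, hφ j⟩
      rw [sawGraph_adj_inl_inl]
      simp only
      omega
    · refine ⟨_, _, ?_, hφ i, hφ0 j h.2⟩
      rw [sawGraph_adj_inl_inl]
      simp only
      omega
    · refine ⟨_, _, ?_, hφ0 i h.2, hφ j⟩
      rw [sawGraph_adj_inl_inl]
      simp only
      omega
  · exact hinl i j hab
  · obtain ⟨u, v, huv, hu, hv⟩ := hinl j i hab.symm
    exact ⟨v, u, huv.symm, hv, hu⟩
  · exact absurd hab sawGraph_adj_inr_inr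

/-- The glued triangle formula at the last edge, with deletion and contraction identified through
`sawGraphDeleteIso` and `sawContractMap`. -/
theorem klPoly_sawInsertLast (T : Finset (Fin (m + 2))) :
    (sawGraph (m + 3) (sawInsertLast T)).klPoly =
      (sawGraph (m + 4) (sawLift T)).klPoly - Polynomial.X * (sawGraph (m + 2) T).klPoly := by
  have hab : (sawGraph (m + 3) (sawInsertLast T)).Adj (.inl (Fin.last _)) (.inl 0) := by
    rw [sawGraph_adj_inl_inl]
    simp
  have hc : ∀ x, (sawGraph (m + 3) (sawInsertLast T)).Adj (.inr (lastTip T)) x ↔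
      x = .inl (Fin.last _) ∨ x = .inl 0 := by
    rintro (i | i)
    · rw [sawGraph_adj_inr_inl]
      simp only [lastTip_val, true_and, Sum.inl.injEq, Fin.ext_iff, Fin.val_last, Fin.val_zero]
      omega
    · simp [sawGraph_adj_inr_inr]
  -- The rest of the cycle, walked down from `m + 2` to `0`, avoids the triangle; so the last edge
  -- is no bridge.
  have hr : ∀ k (hk : k < m + 3),
      (fromEdgeSet ((sawGraph (m + 3) (sawInsertLast T)).edgeSet \ lastTriangle T)).Reachable
        (.inl ⟨k, hk⟩) (.inl 0) := by
    intro k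
    induction k with
    | zero => exact fun _ => Reachable.refl _
    | succ k ih =>
      intro hk
      refine Reachable.trans (reachable_fromEdgeSet_of_mem ⟨?_, ?_⟩) (ih (by omega))
      · rw [mem_edgeSet, sawGraph_adj_inl_inl]
        simp
      · simp [lastTriangle, Fin.ext_iff]
        omega
  rw [klPoly_eq_of_glued_triangle hab hc (hr (m + 2) (by omega)), (sawGraphDeleteIso T).klPoly_eq]
  congr 2
  refine klPoly_contract_eq (F := lastTriangle T) (sawContractMap T) ?_ sawContractMap_eq_iff
    (fun _ _ => sawContractMap_adj) fun _ _ => exists_adj_sawContractMap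
  rintro x (rfl | rfl | rfl)
  · exact hab
  · exact ((hc _).2 (Or.inl rfl)).symm
  · exact ((hc _).2 (Or.inr rfl)).symm

theorem exists_klPoly_sawGraph_eq (S : Finset (Fin (m + 3))) (hS : S.Nonempty) :
    ∃ (S₁ : Finset (Fin (m + 4))) (S₂ : Finset (Fin (m + 2))),
      S₁.card + 1 = S.card ∧ S₂.card + 1 = S.card ∧
      (sawGraph (m + 3) S).klPoly =
        (sawGraph (m + 4) S₁).klPoly - Polynomial.X * (sawGraph (m + 2) S₂).klPoly := by
  obtain ⟨i, hi⟩ := hS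
  -- Rotate so that a chosen edge becomes the last one.
  have hlast : Fin.last (m + 2) ∈
      S.map (Equiv.addRight (Fin.last (m + 2) - i)).toEmbedding := by
    rw [Finset.mem_map]
    exact ⟨i, hi, add_sub_cancel i (Fin.last (m + 2))⟩
  obtain ⟨T, hT⟩ := exists_sawInsertLast_eq hlast
  have hcard : T.card + 1 = S.card := by
    rw [← card_sawInsertLast, hT, Finset.card_map]
  refine ⟨sawLift T, T, by rw [card_sawLift, hcard], hcard, ?_⟩
  rw [(sawGraphRotate (m + 1) S (Fin.last (m + 2) - i)).klPoly_eq, ← klPoly_sawInsertLast, hT]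

end recursion

end SimpleGraph

/-! ### Base cases: no triangles, and `n = 2`. -/

namespace SimpleGraph

theorem klPoly_cycleGraph_two : (cycleGraph 2).klPoly = 1 := by
  have hadj : (cycleGraph 2).Adj 0 1 := by simp [cycleGraph_two_eq_top]
  have hE : (cycleGraph 2).edgeSet = {s(0, 1)} := by
    refine Set.eq_singleton_iff_unique_mem.2 ⟨hadj, fun e he => ?_⟩
    induction e using Sym2.ind with
    | _ i j =>
      have hne : i ≠ j := (cycleGraph 2).ne_of_adj he
      fin_cases i <;> fin_cases j <;> simp_all
  have hM : (cycleGraph 2).graphicMatroid.E = {s(0, 1)} := hE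
  have h : (cycleGraph 2).graphicMatroid.IsParallelColoop {s(0, 1)} := by
    refine ⟨Set.singleton_nonempty _, hM.ge, ?_, ?_⟩
    · rintro _ rfl
      exact Matroid.subset_closure _ _ hM.ge
    · rw [hM, Set.sdiff_self]
      exact Matroid.isFlat_empty _
  rw [klPoly, h.klPoly_eq]
  refine Matroid.klPoly_of_natRank_eq_zero ?_
  rw [Matroid.natRank, Matroid.contract_ground, hM, Set.sdiff_self]
  simp [Matroid.natRk]

theorem klPoly_sawGraph_empty (n : ℕ) : (sawGraph n ∅).klPoly = (cycleGraph n).klPoly := by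
  refine Iso.klPoly_eq ⟨Equiv.sumEmpty (Fin n) (∅ : Finset (Fin n)), ?_⟩
  rintro (i | i) (j | j)
  · exact Iff.rfl
  · exact (Finset.notMem_empty _ j.2).elim
  · exact (Finset.notMem_empty _ i.2).elim
  · exact (Finset.notMem_empty _ i.2).elim

theorem klPoly_sawGraph_two_of_card_eq_one {S : Finset (Fin 2)} (hS : S.card = 1) :
    (sawGraph 2 S).klPoly = (cycleGraph 3).klPoly := by
  have htop : sawGraph 2 S = ⊤ := by
    ext u v
    rw [top_adj]
    refine ⟨Adj.ne, fun huv => ?_⟩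
    rcases u with i | i <;> rcases v with j | j
    · have hij : i.val ≠ j.val := fun h => huv (congrArg Sum.inl (Fin.ext h))
      rw [sawGraph_adj_inl_inl]
      omega
    · rw [sawGraph_adj_inl_inr]
      omega
    · rw [sawGraph_adj_inr_inl]
      omega
    · refine absurd (congrArg Sum.inr (Subtype.ext ?_)) huv
      exact Finset.card_le_one.1 hS.le _ i.2 _ j.2
  rw [htop, cycleGraph_three_eq_top]
  exact Iso.klPoly_eq (Iso.completeGraph (Fintype.equivOfCardEq (by simp [hS])))

/-- The isomorphism between the two descriptions of two triangles with a common edge. -/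
def sawTwoMap : Fin 2 ⊕ (Finset.univ : Finset (Fin 2)) → Fin 3 ⊕ ({0} : Finset (Fin 3))
  | .inl i => .inl i.castSucc
  | .inr s => if s.1 = 0 then .inl 2 else .inr ⟨0, Finset.mem_singleton_self 0⟩

/-- At `n = 2` the recursion would need a cycle of length one, so two triangles on an edge are seen
instead as a 3-cycle with one triangle. -/
theorem klPoly_sawGraph_two_univ :
    (sawGraph 2 Finset.univ).klPoly = (sawGraph 3 {0}).klPoly := by
  have hbij : Function.Bijective sawTwoMap := by decide
  refine Iso.klPoly_eq ⟨Equiv.ofBijective _ hbij, ?_⟩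
  rintro (i | i) (j | j) <;> simp only [Equiv.ofBijective_apply, sawTwoMap]
  · rw [sawGraph_adj_inl_inl, sawGraph_adj_inl_inl]
    simp only [Fin.val_castSucc]
    omega
  · split_ifs with h
    · rw [sawGraph_adj_inl_inl, sawGraph_adj_inl_inr, h]
      revert i
      decide
    · rw [sawGraph_adj_inl_inr, sawGraph_adj_inl_inr]
      simp only [Fin.val_castSucc, Fin.ext_iff, Fin.val_zero] at h ⊢
      omega
  · split_ifs with h
    · rw [sawGraph_adj_inl_inl, sawGraph_adj_inr_inl, h]
      revert j
      decide
    · rw [sawGraph_adj_inr_inl, sawGraph_adj_inr_inl]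
      simp only [Fin.val_castSucc, Fin.ext_iff, Fin.val_zero] at h ⊢
      omega
  · rw [iff_false_right sawGraph_adj_inr_inr]
    split_ifs with h1 h2 h2
    · exact (sawGraph 3 {0}).loopless.irrefl _
    · rw [sawGraph_adj_inl_inr]
      decide
    · rw [sawGraph_adj_inr_inl]
      decide
    · exact sawGraph_adj_inr_inr

end SimpleGraph

/-! ### The closed formula and the theorem. -/

/-- The right hand side of the formula for the Kazhdan–Lusztig polynomial of `S_{n,r}`. -/
noncomputable def sawPoly (n r : ℕ) : ℤ[T;T⁻¹] :=
  ∑ k ∈ Finset.range (r + 1),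
    (-LaurentPolynomial.T 1) ^ k * (r.choose k : ℤ[T;T⁻¹]) * cyclePoly (n + r - 2 * k)

/-- Pascal's rule. The index identities hold for truncated subtraction too, so no bound on `r` is
required. -/
theorem sawPoly_succ (n r : ℕ) :
    sawPoly (n + 1) (r + 1) = sawPoly (n + 2) r - LaurentPolynomial.T 1 * sawPoly n r := by
  -- The added term `k = r + 1` has binomial coefficient zero; it aligns the ranges.
  have h1 : sawPoly (n + 2) r = ∑ k ∈ Finset.range (r + 2), (-LaurentPolynomial.T 1) ^ k *
      (r.choose k : ℤ[T;T⁻¹]) * cyclePoly (n + 2 + r - 2 * k) := by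
    rw [Finset.sum_range_succ, Nat.choose_succ_self]
    simp [sawPoly]
  rw [h1, sawPoly, sawPoly, Finset.sum_range_succ', Finset.sum_range_succ' _ (r + 1),
    Finset.mul_sum, add_sub_right_comm, ← Finset.sum_sub_distrib]
  congr 1
  · refine Finset.sum_congr rfl fun k _ => ?_
    rw [show n + 1 + (r + 1) - 2 * (k + 1) = n + r - 2 * k by omega,
      show n + 2 + r - 2 * (k + 1) = n + r - 2 * k by omega, Nat.choose_succ_succ]
    push_cast
    ring
  · rw [show n + 1 + (r + 1) - 2 * 0 = n + 2 + r - 2 * 0 by omega, Nat.choose_zero_right,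
      Nat.choose_zero_right]

theorem cyclePoly_two : cyclePoly 2 = 1 := by
  simp [cyclePoly, SimpleGraph.klPoly_cycleGraph_two]

/-- Here `p_0 = t⁻¹` is used: `p_4 - 2t p_2 + t² p_0 = p_4 - t p_2`, because `p_2 = 1`. -/
theorem sawPoly_two_two : sawPoly 2 2 = sawPoly 3 1 := by
  have h : LaurentPolynomial.T 1 * LaurentPolynomial.T (-1) = (1 : ℤ[T;T⁻¹]) := by
    rw [← LaurentPolynomial.T_add]
    simp
  simp only [sawPoly, Finset.sum_range_succ, Finset.sum_range_zero]
  simp only [Nat.reduceMul, Nat.reduceAdd, Nat.reduceSub, Nat.choose_zero_right, Nat.choose_self,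
    Nat.choose_one_right, cyclePoly_two, show cyclePoly 0 = LaurentPolynomial.T (-1) from rfl]
  push_cast
  linear_combination LaurentPolynomial.T 1 * h

/-- Induction on `r` with `n` free, since one triangle less comes with a cycle longer or shorter by
one. For `n = 2` and one triangle the formula reads `p_3 - t p_1 = p_3`. -/
theorem toLaurent_klPoly_sawGraph (r n : ℕ) (hn : 2 ≤ n) (S : Finset (Fin n)) (hS : S.card = r) :
    (SimpleGraph.sawGraph n S).klPoly.toLaurent = sawPoly n r := by
  induction r generalizing n with
  | zero =>
    obtain rfl := Finset.card_eq_zero.1 hS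
    obtain ⟨m, rfl⟩ : ∃ m, n = m + 2 := ⟨n - 2, by omega⟩
    rw [SimpleGraph.klPoly_sawGraph_empty]
    simp [sawPoly, cyclePoly]
  | succ r ih =>
    obtain rfl | hn' := hn.eq_or_lt
    · have hle : S.card ≤ 2 := (Finset.card_le_univ S).trans_eq (Fintype.card_fin 2)
      obtain rfl | rfl : r = 0 ∨ r = 1 := by omega
      · rw [SimpleGraph.klPoly_sawGraph_two_of_card_eq_one hS]
        simp [sawPoly, Finset.sum_range_succ, cyclePoly]
      · obtain rfl : S = Finset.univ := Finset.eq_univ_of_card S (by simp [hS])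
        rw [SimpleGraph.klPoly_sawGraph_two_univ, ih 3 (by omega) {0} rfl]
        exact sawPoly_two_two.symm
    · obtain ⟨m, rfl⟩ : ∃ m, n = m + 3 := ⟨n - 3, by omega⟩
      obtain ⟨S₁, S₂, h1, h2, h⟩ := SimpleGraph.exists_klPoly_sawGraph_eq S
        (Finset.card_pos.1 (by omega))
      rw [h, map_sub, map_mul, Polynomial.toLaurent_X, ih _ (by omega) S₁ (by omega),
        ih _ (by omega) S₂ (by omega)]
      exact (sawPoly_succ (m + 2) r).symm

theorem SimpleGraph.IsPartialSaw.toLaurent_klPoly {V : Type*} [Finite V] {G : SimpleGraph V}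
    {n r : ℕ} (hn : 2 ≤ n) (hG : G.IsPartialSaw n r) : G.klPoly.toLaurent = sawPoly n r := by
  obtain ⟨S, hS, ⟨f⟩⟩ := hG
  rw [f.klPoly_eq, toLaurent_klPoly_sawGraph r n hn S hS]

theorem theorem3 {V : Type*} [Finite V] (G : SimpleGraph V) (n r : ℕ) (hn : 2 ≤ n) (hr : r ≤ n)
    (hG : G.IsPartialSaw n r) :
    G.klPoly.toLaurent =
        ∑ k ∈ Finset.range (r + 1),
          (-LaurentPolynomial.T 1) ^ k * (r.choose k : ℤ[T;T⁻¹]) * cyclePoly (n + r - 2 * k) ∧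
      (3 ≤ n → 1 ≤ r →
        ∀ {V₁ V₂ : Type*} [Finite V₁] [Finite V₂] (G₁ : SimpleGraph V₁) (G₂ : SimpleGraph V₂),
          G₁.IsPartialSaw (n + 1) (r - 1) → G₂.IsPartialSaw (n - 1) (r - 1) →
            G.klPoly = G₁.klPoly - Polynomial.X * G₂.klPoly) := by
  refine ⟨hG.toLaurent_klPoly hn, fun hn3 hr1 V₁ V₂ _ _ G₁ G₂ hG₁ hG₂ => ?_⟩
  -- The polynomials depend only on the two parameters, so the recursion for arbitrary choices
  -- follows from that of `sawPoly`.
  apply Polynomial.toLaurent_injective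
  obtain ⟨m, rfl⟩ : ∃ m, n = m + 1 := ⟨n - 1, by omega⟩
  obtain ⟨s, rfl⟩ : ∃ s, r = s + 1 := ⟨r - 1, by omega⟩
  rw [map_sub, map_mul, Polynomial.toLaurent_X, hG.toLaurent_klPoly hn,
    hG₁.toLaurent_klPoly (by omega), hG₂.toLaurent_klPoly (by omega)]
  exact sawPoly_succ m s
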